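/- Let $d\ge 1$ and let $\Delta$ be the set of vectors $h=(h_1,\dots,h_d)$ with $0<h_1\le\dots\le h_d\le 1$. For $h\in\Delta$ let $\mathcal P_h$ be the $d$-dimensional space of exponential polynomials spanned by $e^{-h_it}$, $i=1,\dots,d$, where an exponent $a$ that occurs $m$ times among the $h_i$ contributes $e^{-at},te^{-at},\dots,t^{m-1}e^{-at}$, and let $\|p\|=\sup_{t\ge 0}|p(t)|$. For $\varepsilon>0$ let $\kappa(h,\varepsilon)$ be the value of the problem $$\frac{1-p(0)}{p'(0)-\varepsilon p(0)}\to\min,\qquad p\in\mathcal P_h,\quad \|p\|\le 1,\quad p'(0)>\varepsilon p(0);$$ this minimum is attained for every $h\in\Delta$. Let $e=(1,\dots,1)$. There is a unique $S_d\in\mathcal P_e$ (the Chebyshev polynomial of $\mathcal P_e$) such that $\|S_d\|=1$ and $S_d(\nu_k)=(-1)^k$, $k=1,\dots,d$, for some points $0=\nu_1<\dots<\nu_d$. Then for every $\varepsilon>0$ one has $\kappa(e,\varepsilon)\le\kappa(h,\varepsilon)$ for all $h\in\Delta$, with strict inequality if $h\neq e$. Moreover, the problem defining $\kappa(e,\varepsilon)$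 has a unique optimal polynomial, which is $S_d$ up to a translation of the argument: it is $p(t)=S_d(t+\tau)$, where $\tau\ge 0$ is smaller than every $t\ge0$ with $S_d(t)=1$, and $\tau$ is the unique minimizer of $$\frac{1-S_d(t)}{S_d'(t)-\varepsilon S_d(t)}$$ over all $t\ge 0$ with $S_d'(t)>\varepsilon S_d(t)$. The minimal value of this quotient is $\kappa(e,\varepsilon)$. -/

import Mathlib

open Set

noncomputable section

/-- The basic function attached to the index `i`: `t ^ m * exp (-h i * t)`, where `m` is the number
of earlier indices carrying the same exponent.  Thus an exponent of multiplicity `n` contributes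
`exp (-a * t), t * exp (-a * t), …, t ^ (n - 1) * exp (-a * t)`. -/
def expBasis {d : ℕ} (h : Fin d → ℝ) (i : Fin d) : ℝ → ℝ :=
  fun t => t ^ (Finset.univ.filter (fun j : Fin d => j < i ∧ h j = h i)).card
    * Real.exp (-(h i) * t)

/-- The space of exponential polynomials with exponent vector `h`.  Its elements are kept as
functions on the whole line, which are determined by their restriction to the half-line. -/
def expPoly {d : ℕ} (h : Fin d → ℝ) : Submodule ℝ (ℝ → ℝ) :=
  Submodule.span ℝ (Set.range (expBasis h))

/-- The sup-norm on the half-line `[0, ∞)`. -/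
def halfLineNorm (p : ℝ → ℝ) : ℝ := ⨆ t : Set.Ici (0 : ℝ), |p t|

/-- The set of nondecreasing vectors with entries in `(0, 1]`. -/
def expSimplex (d : ℕ) : Set (Fin d → ℝ) :=
  {h | Monotone h ∧ ∀ i, 0 < h i ∧ h i ≤ 1}

/-- The Chebyshev polynomial of the system with exponent vector `h`: it has norm one and takes
the values `-1, 1, -1, …` at `d` points `0 = ν₁ < ν₂ < … < ν_d`. -/
def IsExpChebyshev {d : ℕ} (h : Fin d → ℝ) (T : ℝ → ℝ) : Prop :=
  T ∈ expPoly h ∧ halfLineNorm T = 1 ∧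
    ∃ ν : Fin d → ℝ, StrictMono ν ∧ (∀ k, k.val = 0 → ν k = 0) ∧
      ∀ k, T (ν k) = (-1) ^ (k.val + 1)

/-- The feasible set of the extremal problem. -/
def feasible {d : ℕ} (h : Fin d → ℝ) (ε : ℝ) : Set (ℝ → ℝ) :=
  {p | p ∈ expPoly h ∧ halfLineNorm p ≤ 1 ∧ ε * p 0 < deriv p 0}

/-- The objective function of the extremal problem. -/
def objective (ε : ℝ) (p : ℝ → ℝ) : ℝ := (1 - p 0) / (deriv p 0 - ε * p 0)

/-- The value of the extremal problem. -/
def kappa {d : ℕ} (h : Fin d → ℝ) (ε : ℝ) : ℝ := sInf (objective ε '' feasible h ε)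

/-- Optimal elements of the extremal problem. -/
def IsOptimal {d : ℕ} (h : Fin d → ℝ) (ε : ℝ) (p : ℝ → ℝ) : Prop :=
  p ∈ feasible h ε ∧ ∀ q ∈ feasible h ε, objective ε p ≤ objective ε q

end

open Filter Topology

/-! An exponential polynomial with n exponents, counted with multiplicity, is annihilated by the
product of the operators D + a. Rolle's theorem applied to exp(at) f shows, by induction on n, that
it vanishes once it alternates weakly at n + 1 points (`expKer_eq_zero_of_alternating`). Positive
exponents force decay, so infinity supplies one more Rolle point, and a sign of the derivative at
the left end counts as one more condition (`expKer_eq_zero_of_alternating_deriv`). The rest is sign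
counting based on these two facts.

The fractional problem is linearised: if κ is its value, the functional κ p'(0) + (1 - κε) p(0) is
at most 1 on the unit ball, with equality exactly at the optimal elements. A Kolmogorov-type
perturbation then shows that, for n ≥ 2, an optimal p takes the values 1, -1, 1, … at n - 1 positive
points (`IsExpOptimal.exists_alternation`). The midpoint of two optimal elements is optimal too, and
its alternation forces them to coincide (`IsExpOptimal.unique`).

To compare exponent vectors, let p be optimal and raise its least exponent. In the new space choose
q with the zeros of p that the alternation provides and with matching data at 0. For t > 0 off these
zeros, write q(t) = c p(t). The difference q - c p lies in a space only one dimension larger, so its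
zeros link its sign near 0 to its sign near infinity, where p dominates; this gives 0 < c < 1. If
p(0) < 0, matching p(0) yields q'(0) > p'(0). If p(0) ≥ 0, matching p(0) and p'(0) yields a norm
below 1, and rescaling helps. Either way the value drops (`IsExpOptimal.exists_better`); repeating
this until all exponents are 1 proves the comparison.

For exponents 1 an optimal p increases up to 0. Being a polynomial times exp(-t), it is unbounded on
the left, so it reaches -1 at some r ≤ 0. Shifting r to the origin gives the Chebyshev polynomial
(`IsExpOptimal.exists_isExpChebyshev`). -/

/-! ### Kernels of products of first-order operators and their Chebyshev property -/

/-- The kernel of the differential operator `∏ (D + a)`, `a ∈ L`. -/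
def expKer : List ℝ → Submodule ℝ (ℝ → ℝ)
  | [] => ⊥
  | a :: L =>
    { carrier := {f | Differentiable ℝ f ∧ (fun t => deriv f t + a * f t) ∈ expKer L}
      add_mem' := by
        rintro f g ⟨hf, hf'⟩ ⟨hg, hg'⟩
        refine ⟨hf.add hg, ?_⟩
        convert (expKer L).add_mem hf' hg' using 1
        funext t
        simp only [Pi.add_apply, deriv_add (hf t) (hg t)]
        ring
      zero_mem' := by
        refine ⟨differentiable_const 0, ?_⟩
        convert (expKer L).zero_mem using 1
        funext t
        simp
      smul_mem' := by
        rintro c f ⟨hf, hf'⟩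
        refine ⟨hf.const_smul c, ?_⟩
        convert (expKer L).smul_mem c hf' using 1
        funext t
        simp only [Pi.smul_apply, smul_eq_mul, deriv_const_smul c (hf t)]
        ring }

theorem mem_expKer_nil {f : ℝ → ℝ} : f ∈ expKer [] ↔ f = 0 := Iff.rfl

theorem mem_expKer_cons {a : ℝ} {L : List ℝ} {f : ℝ → ℝ} :
    f ∈ expKer (a :: L) ↔
      Differentiable ℝ f ∧ (fun t => deriv f t + a * f t) ∈ expKer L := Iff.rfl

theorem differentiable_of_mem_expKer {L : List ℝ} {f : ℝ → ℝ} (hf : f ∈ expKer L) :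
    Differentiable ℝ f := by
  cases L with
  | nil => rw [mem_expKer_nil.1 hf]; exact differentiable_const 0
  | cons a L => exact (mem_expKer_cons.1 hf).1

theorem deriv_mem_expKer {L : List ℝ} : ∀ {f : ℝ → ℝ}, f ∈ expKer L → deriv f ∈ expKer L := by
  induction L with
  | nil =>
    intro f hf
    rw [mem_expKer_nil.1 hf, mem_expKer_nil]
    funext t
    simp
  | cons a L ih =>
    intro f hf
    obtain ⟨hd, hg⟩ := mem_expKer_cons.1 hf
    have hgd := differentiable_of_mem_expKer hg
    have hdd : Differentiable ℝ (deriv f) := by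
      have : deriv f = fun t => (deriv f t + a * f t) - a * f t := by funext t; ring
      rw [this]
      exact hgd.sub (hd.const_mul a)
    refine mem_expKer_cons.2 ⟨hdd, ?_⟩
    convert ih hg using 1
    funext t
    rw [deriv_fun_add (hdd t) ((hd t).const_mul a), deriv_const_mul a (hd t)]

theorem expKer_le_cons (a : ℝ) (L : List ℝ) : expKer L ≤ expKer (a :: L) := fun _ hf =>
  mem_expKer_cons.2 ⟨differentiable_of_mem_expKer hf,
    (expKer L).add_mem (deriv_mem_expKer hf) ((expKer L).smul_mem a hf)⟩

theorem expKer_le_append_singleton (a : ℝ) (L : List ℝ) : expKer L ≤ expKer (L ++ [a]) := by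
  induction L with
  | nil =>
    intro f hf
    rw [mem_expKer_nil.1 hf]
    exact Submodule.zero_mem _
  | cons b L ih => exact fun f hf => mem_expKer_cons.2 ⟨(mem_expKer_cons.1 hf).1,
      ih (mem_expKer_cons.1 hf).2⟩

/-- Dropping exponents gives subspaces of every smaller dimension, which allows functions whose
zeros are exactly a prescribed set of fewer points. -/
theorem expKer_drop_le (k : ℕ) (L : List ℝ) : expKer (L.drop k) ≤ expKer L := by
  induction L generalizing k with
  | nil => simp
  | cons a L ih =>
    cases k with
    | zero => simp
    | succ k => exact (ih k).trans (expKer_le_cons a L)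

theorem translate_mem_expKer {L : List ℝ} (s : ℝ) :
    ∀ {f : ℝ → ℝ}, f ∈ expKer L → (fun t => f (t + s)) ∈ expKer L := by
  induction L with
  | nil =>
    intro f hf
    rw [mem_expKer_nil.1 hf, mem_expKer_nil]
    rfl
  | cons a L ih =>
    intro f hf
    obtain ⟨hd, hg⟩ := mem_expKer_cons.1 hf
    refine mem_expKer_cons.2 ⟨hd.comp (differentiable_id.add_const s), ?_⟩
    convert ih hg using 1
    funext t
    rw [deriv_comp_add_const]

/-- A function of `expKer L` that alternates weakly in sign at more than `L.length` points
vanishes. -/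
theorem expKer_eq_zero_of_alternating {L : List ℝ} : ∀ {f : ℝ → ℝ}, f ∈ expKer L →
    ∀ x : ℕ → ℝ, (∀ i < L.length, x i < x (i + 1)) →
      (∀ i ≤ L.length, 0 ≤ (-1) ^ i * f (x i)) → f = 0 := by
  induction L with
  | nil => exact fun hf _ _ _ => mem_expKer_nil.1 hf
  | cons a L ih =>
    intro f hf x hx hs
    obtain ⟨hd, hg⟩ := mem_expKer_cons.1 hf
    -- The integrating factor exp(at) turns D + a into a plain derivative, to which the mean value
    -- theorem applies.
    have hder : ∀ t, HasDerivAt (fun t => Real.exp (a * t) * f t)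
        (Real.exp (a * t) * (deriv f t + a * f t)) t := by
      intro t
      have h1 : HasDerivAt (fun t : ℝ => Real.exp (a * t)) (Real.exp (a * t) * a) t := by
        simpa using ((hasDerivAt_id t).const_mul a).exp
      exact (h1.fun_mul (hd t).hasDerivAt).congr_deriv (by ring)
    have key : ∀ i, ∃ ξ, i < L.length + 1 → x i < ξ ∧ ξ < x (i + 1) ∧
        0 ≤ (-1) ^ i * -(deriv f ξ + a * f ξ) := by
      intro i
      by_cases hi : i < L.length + 1
      · obtain ⟨ξ, hξ, he⟩ := exists_hasDerivAt_eq_slope _ _ (hx i hi)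
          (fun t _ => (hder t).continuousAt.continuousWithinAt) (fun t _ => hder t)
        refine ⟨ξ, fun _ => ⟨hξ.1, hξ.2, ?_⟩⟩
        rw [eq_div_iff (sub_pos.2 (hx i hi)).ne'] at he
        have h0 := mul_nonneg (Real.exp_pos (a * x i)).le (hs i hi.le)
        have h1 := mul_nonneg (Real.exp_pos (a * x (i + 1))).le (hs (i + 1) hi)
        have h2 : 0 ≤ (Real.exp (a * ξ) * (x (i + 1) - x i)) *
            ((-1) ^ i * -(deriv f ξ + a * f ξ)) := by
          have : (Real.exp (a * ξ) * (x (i + 1) - x i)) * ((-1) ^ i * -(deriv f ξ + a * f ξ))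
            = -(-1) ^ i * (Real.exp (a * ξ) * (deriv f ξ + a * f ξ) * (x (i + 1) - x i)) := by
            ring
          rw [this, he]
          rw [pow_succ] at h1
          linarith
        exact nonneg_of_mul_nonneg_right h2
          (mul_pos (Real.exp_pos _) (sub_pos.2 (hx i hi)))
      · exact ⟨0, fun h => absurd h hi⟩
    choose ξ hξ using key
    have hz := ih ((expKer L).neg_mem hg) ξ
      (fun i hi => (hξ i (by omega)).2.1.trans (hξ (i + 1) (by omega)).1)
      (fun i hi => (hξ i (by omega)).2.2)
    have hz' : ∀ t, deriv f t + a * f t = 0 := fun t => by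
      have : -(deriv f t + a * f t) = 0 := congrFun hz t
      linarith
    have hconst : ∀ t, Real.exp (a * t) * f t = Real.exp (a * x 0) * f (x 0) := fun t =>
      is_const_of_deriv_eq_zero (fun t => (hder t).differentiableAt)
        (fun t => by rw [(hder t).deriv, hz', mul_zero]) t (x 0)
    -- A constant multiple of exp(-at) cannot have weakly opposite signs at two points unless it is
    -- zero.
    have h0 := hs 0 (by simp)
    have h1 := hs 1 (by simp)
    have hf0 : f (x 0) = 0 := by
      have h2 := hconst (x 1)
      have h3 := mul_nonneg (Real.exp_pos (a * x 1)).le h1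
      simp only [pow_zero, one_mul, pow_one] at h0 h3
      refine le_antisymm ?_ h0
      by_contra! h4
      have := mul_pos (Real.exp_pos (a * x 0)) h4
      linarith
    funext t
    have := hconst t
    rw [hf0, mul_zero] at this
    exact (mul_eq_zero.1 this).resolve_left (Real.exp_pos _).ne'

/-- Increasing enumeration of a finite set of reals, with the signs of the differences. -/
theorem exists_increasing_enum (X : Finset ℝ) : ∃ x : ℕ → ℝ,
    (∀ i, i + 1 < X.card → x i < x (i + 1)) ∧
    ∀ i < X.card, x i ∈ X ∧ 0 < (-1) ^ i * ∏ z ∈ X.erase (x i), (z - x i) := by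
  induction X using Finset.induction_on_max with
  | empty => exact ⟨fun _ => 0, by simp, by simp⟩
  | insert m X hm ih =>
    obtain ⟨x, hx, hs⟩ := ih
    have hmX : m ∉ X := fun h => lt_irrefl _ (hm m h)
    have hneg : ∀ Y : Finset ℝ, (∀ z ∈ Y, z < m) → 0 < (-1) ^ Y.card * ∏ z ∈ Y, (z - m) := by
      intro Y hY
      rw [← Finset.prod_const, ← Finset.prod_mul_distrib]
      exact Finset.prod_pos fun z hz => by linarith [hY z hz]
    refine ⟨fun i => if i < X.card then x i else m, ?_, ?_⟩
    · intro i hi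
      rw [Finset.card_insert_of_notMem hmX] at hi
      have hi' : i < X.card := by omega
      simp only [hi', if_true]
      split_ifs with h
      · exact hx i h
      · exact hm _ (hs i hi').1
    · intro i hi
      rw [Finset.card_insert_of_notMem hmX] at hi
      by_cases h : i < X.card
      · simp only [h, if_true]
        have hlt := hm _ (hs i h).1
        refine ⟨Finset.mem_insert_of_mem (hs i h).1, ?_⟩
        rw [Finset.erase_insert_of_ne hlt.ne', Finset.prod_insert (by simp [hmX])]
        have := mul_pos (sub_pos.2 hlt) (hs i h).2
        linarith
      · have : i = X.card := by omega
        simp only [h, if_false]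
        refine ⟨Finset.mem_insert_self _ _, ?_⟩
        rw [Finset.erase_insert hmX, this]
        exact hneg X hm

/-- The product has the sign (-1)^m, where m is the number of points of `X` below x. The hypothesis
is thus weak alternation, expressed without ordering the points. -/
theorem expKer_eq_zero_of_sign {L : List ℝ} {f : ℝ → ℝ} (hf : f ∈ expKer L) (X : Finset ℝ)
    (hX : X.card = L.length + 1) (hs : ∀ x ∈ X, 0 ≤ f x * ∏ z ∈ X.erase x, (z - x)) :
    f = 0 := by
  obtain ⟨x, hx, hxs⟩ := exists_increasing_enum X
  refine expKer_eq_zero_of_alternating hf x (fun i hi => hx i (by omega)) fun i hi => ?_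
  obtain ⟨hm, hp⟩ := hxs i (by omega)
  have h1 := mul_nonneg (hs _ hm) hp.le
  have hP : ∏ z ∈ X.erase (x i), (z - x i) ≠ 0 := fun h => by simp [h] at hp
  refine nonneg_of_mul_nonneg_left (b := (∏ z ∈ X.erase (x i), (z - x i)) ^ 2) ?_ (by positivity)
  linarith

/-- At one extra point M, either f or -f has the sign that completes a weak alternation. -/
theorem expKer_eq_zero_of_zeros {L : List ℝ} {f : ℝ → ℝ} (hf : f ∈ expKer L) (X : Finset ℝ)
    (hX : X.card = L.length) (hs : ∀ x ∈ X, f x = 0) : f = 0 := by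
  obtain ⟨M, hM⟩ := Infinite.exists_notMem_finset X
  have key : ∀ g ∈ expKer L, (∀ x ∈ X, g x = 0) → 0 ≤ g M * ∏ z ∈ X, (z - M) → g = 0 := by
    intro g hg hgX hgM
    refine expKer_eq_zero_of_sign hg (insert M X) (by simp [hM, hX]) fun x hx => ?_
    rcases Finset.mem_insert.1 hx with rfl | hx
    · rwa [Finset.erase_insert hM]
    · simp [hgX x hx]
  rcases le_total 0 (f M * ∏ z ∈ X, (z - M)) with h | h
  · exact key f hf hs h
  · refine neg_eq_zero.1 (key (-f) ((expKer L).neg_mem hf) (fun x hx => by simp [hs x hx]) ?_)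
    simpa using h

/-- A nonzero function of `expKer L` with `L.length - 1` prescribed zeros has no other zeros and
changes sign exactly at these zeros. -/
theorem expKer_sign_of_zeros {L : List ℝ} {f : ℝ → ℝ} (hf : f ∈ expKer L) (hf0 : f ≠ 0)
    (Z : Finset ℝ) (hZ : Z.card + 1 = L.length) (hz : ∀ z ∈ Z, f z = 0) {s t : ℝ}
    (hs : s ∉ Z) (ht : t ∉ Z) :
    0 < (f s * ∏ z ∈ Z, (z - s)) * (f t * ∏ z ∈ Z, (z - t)) := by
  have key : ∀ g ∈ expKer L, g ≠ 0 → (∀ z ∈ Z, g z = 0) → ∀ s t, s ∉ Z → t ∉ Z → s < t →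
      0 ≤ g s * ∏ z ∈ Z, (z - s) → 0 < g t * ∏ z ∈ Z, (z - t) := by
    intro g hg hg0 hgz s t hs ht hst h1
    by_contra! h2
    refine hg0 (expKer_eq_zero_of_sign hg (insert s (insert t Z)) ?_ fun x hx => ?_)
    · rw [Finset.card_insert_of_notMem (by simp [hs, hst.ne]), Finset.card_insert_of_notMem ht]
      omega
    · rcases Finset.mem_insert.1 hx with rfl | hx
      · rw [Finset.erase_insert (by simp [hs, hst.ne]), Finset.prod_insert ht]
        have := mul_nonneg h1 (sub_pos.2 hst).le
        linarith
      · rcases Finset.mem_insert.1 hx with rfl | hx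
        · rw [Finset.erase_insert_of_ne hst.ne, Finset.erase_insert ht,
            Finset.prod_insert hs]
          have := mul_nonneg_of_nonpos_of_nonpos h2 (sub_neg.2 hst).le
          linarith
        · simp [hgz x hx]
  have hlt : ∀ s t, s ∉ Z → t ∉ Z → s < t →
      0 < (f s * ∏ z ∈ Z, (z - s)) * (f t * ∏ z ∈ Z, (z - t)) := by
    intro s t hs ht hst
    have hm := key (-f) ((expKer L).neg_mem hf) (neg_ne_zero.2 hf0)
      (fun z h => by simp [hz z h]) s t hs ht hst
    simp only [Pi.neg_apply, neg_mul] at hm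
    have hp := key f hf hf0 hz s t hs ht hst
    rcases lt_trichotomy (f s * ∏ z ∈ Z, (z - s)) 0 with h | h | h
    · exact mul_pos_of_neg_of_neg h (by linarith [hm (by linarith)])
    · linarith [hm (by linarith), hp h.ge]
    · exact mul_pos h (hp h.le)
  rcases lt_trichotomy s t with h | h | h
  · exact hlt s t hs ht h
  · subst h
    by_contra! h2
    -- The claim at a single point says that f has no zero off `Z`; a third point M reduces it to
    -- the case of distinct points.
    have h3 : f s * ∏ z ∈ Z, (z - s) = 0 := by nlinarith
    obtain ⟨M, hM⟩ := Infinite.exists_notMem_finset (insert s Z)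
    simp only [Finset.mem_insert, not_or] at hM
    rcases lt_or_gt_of_ne hM.1 with h | h
    · have := hlt M s hM.2 hs h
      simp [h3] at this
    · have := hlt s M hs hM.2 h
      simp [h3] at this
  · rw [mul_comm]
    exact hlt t s ht hs h

/-! ### Bases, dimension and interpolation -/

/-- The exponential monomial `t ^ k * exp (-b * t)`. -/
noncomputable def expMonomial (k : ℕ) (b : ℝ) : ℝ → ℝ := fun t => t ^ k * Real.exp (-b * t)

/-- The exponential monomials attached to a list of exponents. -/
def expMonomials (L : List ℝ) : Set (ℝ → ℝ) :=
  {f | ∃ k b, k < L.count b ∧ f = expMonomial k b}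

theorem hasDerivAt_expMonomial (k : ℕ) (b t : ℝ) :
    HasDerivAt (expMonomial k b)
      (k * expMonomial (k - 1) b t + -b * expMonomial k b t) t := by
  have h1 : HasDerivAt (fun t : ℝ => Real.exp (-b * t)) (Real.exp (-b * t) * -b) t := by
    simpa using ((hasDerivAt_id t).const_mul (-b)).exp
  exact ((hasDerivAt_pow k t).fun_mul h1).congr_deriv (by simp only [expMonomial]; ring)

theorem expMonomial_mem_expKer {L : List ℝ} :
    ∀ {k : ℕ} {b : ℝ}, k < L.count b → expMonomial k b ∈ expKer L := by
  induction L with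
  | nil => intro k b h; simp at h
  | cons a L ih =>
    intro k b h
    refine mem_expKer_cons.2 ⟨fun t => (hasDerivAt_expMonomial k b t).differentiableAt, ?_⟩
    have he : (fun t => deriv (expMonomial k b) t + a * expMonomial k b t) =
        (k : ℝ) • expMonomial (k - 1) b + (a - b) • expMonomial k b := by
      funext t
      rw [(hasDerivAt_expMonomial k b t).deriv]
      simp only [Pi.add_apply, Pi.smul_apply, smul_eq_mul]
      ring
    rw [he]
    by_cases hab : a = b
    · subst hab
      rw [List.count_cons_self] at h
      rw [sub_self, zero_smul, add_zero]
      cases k with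
      | zero => simp
      | succ k => exact Submodule.smul_mem _ _ (ih (by simpa using h))
    · rw [List.count_cons_of_ne (by simpa using hab)] at h
      exact Submodule.add_mem _ (Submodule.smul_mem _ _ (ih (by omega)))
        (Submodule.smul_mem _ _ (ih h))

theorem span_expMonomials_le (L : List ℝ) : Submodule.span ℝ (expMonomials L) ≤ expKer L := by
  rw [Submodule.span_le]
  rintro f ⟨k, b, h, rfl⟩
  exact expMonomial_mem_expKer h

/-- In the resonant case a = b the degree rises by one. Otherwise (D + a) multiplies the monomial by
a - b and adds a term of lower degree, which the induction removes. -/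
theorem exists_primitive_expMonomial (a : ℝ) {L : List ℝ} (b : ℝ) :
    ∀ k, k < L.count b → ∃ F ∈ Submodule.span ℝ (expMonomials (a :: L)),
      ∀ t, deriv F t + a * F t = expMonomial k b t := by
  intro k
  induction k with
  | zero =>
    intro h
    by_cases hab : a = b
    · subst hab
      refine ⟨expMonomial 1 a, Submodule.subset_span ⟨1, a, by simpa using h, rfl⟩, fun t => ?_⟩
      rw [(hasDerivAt_expMonomial 1 a t).deriv]
      simp
    · have hab' := sub_ne_zero.2 hab
      refine ⟨(a - b)⁻¹ • expMonomial 0 b, Submodule.smul_mem _ _ (Submodule.subset_span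
        ⟨0, b, by rwa [List.count_cons_of_ne (by simpa using hab)], rfl⟩), fun t => ?_⟩
      rw [((hasDerivAt_expMonomial 0 b t).const_smul _).deriv]
      simp only [Pi.smul_apply, smul_eq_mul]
      field_simp
      simp
      ring
  | succ k ih =>
    intro h
    by_cases hab : a = b
    · subst hab
      refine ⟨((k + 2 : ℝ))⁻¹ • expMonomial (k + 2) a, Submodule.smul_mem _ _
        (Submodule.subset_span ⟨k + 2, a, by rw [List.count_cons_self]; omega, rfl⟩), fun t => ?_⟩
      rw [((hasDerivAt_expMonomial (k + 2) a t).const_smul _).deriv]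
      simp only [Pi.smul_apply, smul_eq_mul]
      have : (k + 2 : ℝ) ≠ 0 := by positivity
      field_simp
      push_cast
      ring
    · obtain ⟨G, hG, hGe⟩ := ih (by omega)
      have hab' := sub_ne_zero.2 hab
      have hGd := differentiable_of_mem_expKer (span_expMonomials_le _ hG)
      refine ⟨(a - b)⁻¹ • (expMonomial (k + 1) b - (k + 1 : ℝ) • G),
        Submodule.smul_mem _ _ (Submodule.sub_mem _ (Submodule.subset_span
        ⟨k + 1, b, by rwa [List.count_cons_of_ne (by simpa using hab)], rfl⟩)
        (Submodule.smul_mem _ _ hG)), fun t => ?_⟩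
      rw [(((hasDerivAt_expMonomial (k + 1) b t).sub
        ((hGd t).hasDerivAt.const_smul _)).const_smul _).deriv]
      have := hGe t
      have hd : deriv G t = expMonomial k b t - a * G t := by linarith
      simp only [Pi.smul_apply, Pi.sub_apply, smul_eq_mul, hd]
      field_simp
      push_cast
      ring

theorem exists_primitive_span (a : ℝ) {L : List ℝ} {g : ℝ → ℝ}
    (hg : g ∈ Submodule.span ℝ (expMonomials L)) :
    ∃ F ∈ Submodule.span ℝ (expMonomials (a :: L)), ∀ t, deriv F t + a * F t = g t := by
  induction hg using Submodule.span_induction with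
  | mem g hg =>
    obtain ⟨k, b, h, rfl⟩ := hg
    exact exists_primitive_expMonomial a b k h
  | zero => exact ⟨0, Submodule.zero_mem _, fun t => by simp⟩
  | add x y _ _ hx hy =>
    obtain ⟨F, hF, hFe⟩ := hx
    obtain ⟨G, hG, hGe⟩ := hy
    refine ⟨F + G, Submodule.add_mem _ hF hG, fun t => ?_⟩
    rw [deriv_add (differentiable_of_mem_expKer (span_expMonomials_le _ hF) t)
      (differentiable_of_mem_expKer (span_expMonomials_le _ hG) t), Pi.add_apply, Pi.add_apply,
      ← hFe, ← hGe]
    ring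
  | smul c x _ hx =>
    obtain ⟨F, hF, hFe⟩ := hx
    refine ⟨c • F, Submodule.smul_mem _ c hF, fun t => ?_⟩
    rw [deriv_const_smul c (differentiable_of_mem_expKer (span_expMonomials_le _ hF) t),
      Pi.smul_apply, Pi.smul_apply, ← hFe]
    simp only [smul_eq_mul]
    ring

theorem expKer_eq_span (L : List ℝ) : expKer L = Submodule.span ℝ (expMonomials L) := by
  refine le_antisymm ?_ (span_expMonomials_le L)
  induction L with
  | nil => exact bot_le
  | cons a L ih =>
    intro f hf
    obtain ⟨hd, hg⟩ := mem_expKer_cons.1 hf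
    obtain ⟨F, hF, hFe⟩ := exists_primitive_span a (ih hg)
    have hFd := differentiable_of_mem_expKer (span_expMonomials_le _ hF)
    have hder : ∀ t, HasDerivAt (fun t => Real.exp (a * t) * (f t - F t)) 0 t := by
      intro t
      have h1 : HasDerivAt (fun t : ℝ => Real.exp (a * t)) (Real.exp (a * t) * a) t := by
        simpa using ((hasDerivAt_id t).const_mul a).exp
      refine (h1.fun_mul ((hd t).hasDerivAt.fun_sub (hFd t).hasDerivAt)).congr_deriv ?_
      have := hFe t
      have h2 : deriv F t = deriv f t + a * f t - a * F t := by linarith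
      rw [h2]
      ring
    have hconst : ∀ t, Real.exp (a * t) * (f t - F t) = f 0 - F 0 := fun t => by
      have := is_const_of_deriv_eq_zero (fun t => (hder t).differentiableAt)
        (fun t => (hder t).deriv) t 0
      simpa using this
    have : f = F + (f 0 - F 0) • expMonomial 0 a := by
      funext t
      rw [← hconst t]
      simp only [Pi.add_apply, Pi.smul_apply, expMonomial, smul_eq_mul, pow_zero, one_mul, neg_mul,
        Real.exp_neg]
      have := (Real.exp_pos (a * t)).ne'
      field_simp
      ring
    rw [this]
    exact Submodule.add_mem _ hF (Submodule.smul_mem _ _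
      (Submodule.subset_span ⟨0, a, by simp, rfl⟩))

instance finiteDimensional_expKer (L : List ℝ) : FiniteDimensional ℝ (expKer L) := by
  obtain ⟨X, hX⟩ := Infinite.exists_subset_card_eq ℝ L.length
  let φ : expKer L →ₗ[ℝ] (X → ℝ) :=
    { toFun := fun f x => f.1 x
      map_add' := fun _ _ => rfl
      map_smul' := fun _ _ => rfl }
  refine Module.Finite.of_injective φ ((injective_iff_map_eq_zero φ).2 fun f hf => ?_)
  exact Subtype.ext (expKer_eq_zero_of_zeros f.2 X hX fun x hx => congrFun hf ⟨x, hx⟩)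

/-- Each operator D + a maps onto the next kernel and annihilates exp(-at), so each exponent adds at
least one dimension. -/
theorem length_le_finrank_expKer (L : List ℝ) : L.length ≤ Module.finrank ℝ (expKer L) := by
  induction L with
  | nil => simp
  | cons a L ih =>
    let T : expKer (a :: L) →ₗ[ℝ] expKer L :=
      { toFun := fun f => ⟨_, (mem_expKer_cons.1 f.2).2⟩
        map_add' := fun f g => by
          ext t
          simp only [Submodule.coe_add, Pi.add_apply,
            deriv_add (differentiable_of_mem_expKer f.2 t) (differentiable_of_mem_expKer g.2 t)]
          ring
        map_smul' := fun c f => by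
          ext t
          simp only [Submodule.coe_smul, Pi.smul_apply, smul_eq_mul, RingHom.id_apply,
            deriv_const_smul c (differentiable_of_mem_expKer f.2 t)]
          ring }
    have hT : LinearMap.range T = ⊤ := by
      rw [LinearMap.range_eq_top]
      rintro ⟨g, hg⟩
      obtain ⟨F, hF, hFe⟩ := exists_primitive_span a ((expKer_eq_span L).le hg)
      exact ⟨⟨F, span_expMonomials_le _ hF⟩, Subtype.ext (funext hFe)⟩
    have hk : 0 < Module.finrank ℝ (LinearMap.ker T) := by
      refine (Module.finrank_pos_iff_exists_ne_zero (R := ℝ) (M := LinearMap.ker T)).2 ?_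
      have hm : expMonomial 0 a ∈ expKer (a :: L) := expMonomial_mem_expKer (by simp)
      refine ⟨⟨⟨_, hm⟩, ?_⟩, fun h => ?_⟩
      · refine Subtype.ext (funext fun t => ?_)
        show deriv (expMonomial 0 a) t + a * expMonomial 0 a t = 0
        rw [(hasDerivAt_expMonomial 0 a t).deriv]
        simp
      · have h0 : expMonomial 0 a 0 = 0 := congrFun (congrArg (fun x => x.1.1) h) 0
        simp [expMonomial] at h0
    have := LinearMap.finrank_range_add_finrank_ker T
    rw [hT, finrank_top] at this
    simp only [List.length_cons]
    omega

/-- Uniqueness of interpolation gives existence, since the dimension is at least the number of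
conditions. -/
theorem expKer_surjective_of_injective {L : List ℝ} {ι : Type*} [Fintype ι]
    (hι : Fintype.card ι = L.length) (φ : expKer L →ₗ[ℝ] (ι → ℝ))
    (hφ : ∀ f, φ f = 0 → f = 0) : Function.Surjective φ := by
  have hinj : Function.Injective φ := (injective_iff_map_eq_zero φ).2 hφ
  refine (LinearMap.injective_iff_surjective_of_finrank_eq_finrank
    (le_antisymm ?_ ?_)).1 hinj
  · exact LinearMap.finrank_le_finrank_of_injective hinj
  · rw [Module.finrank_fintype_fun_eq_card, hι]
    exact length_le_finrank_expKer L

theorem exists_expKer_interpolation {L : List ℝ} (X : Finset ℝ) (hX : X.card = L.length)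
    (v : ℝ → ℝ) : ∃ f ∈ expKer L, ∀ x ∈ X, f x = v x := by
  let φ : expKer L →ₗ[ℝ] (X → ℝ) :=
    { toFun := fun f x => f.1 x
      map_add' := fun _ _ => rfl
      map_smul' := fun _ _ => rfl }
  obtain ⟨f, hf⟩ := expKer_surjective_of_injective (by simpa using hX) φ
    (fun f hf => Subtype.ext
      (expKer_eq_zero_of_zeros f.2 X hX fun x hx => congrFun hf ⟨x, hx⟩)) (fun x => v x)
  exact ⟨f.1, f.2, fun x hx => congrFun hf ⟨x, hx⟩⟩

/-! ### Decay and leading terms at infinity -/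

theorem tendsto_div_of_mem_expKer {L : List ℝ} {f : ℝ → ℝ} (hf : f ∈ expKer L) (w : ℝ → ℝ)
    (hw : ∀ k b, k < L.count b → Tendsto (fun t => expMonomial k b t / w t) atTop (𝓝 0)) :
    Tendsto (fun t => f t / w t) atTop (𝓝 0) := by
  rw [expKer_eq_span] at hf
  induction hf using Submodule.span_induction with
  | mem g hg =>
    obtain ⟨k, b, h, rfl⟩ := hg
    exact hw k b h
  | zero => simp
  | add x y _ _ hx hy => simpa [add_div] using hx.add hy
  | smul c x _ hx => simpa [mul_div_assoc] using hx.const_mul c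

theorem tendsto_expMonomial (k : ℕ) {b : ℝ} (hb : 0 < b) :
    Tendsto (expMonomial k b) atTop (𝓝 0) := by
  refine (tendsto_rpow_mul_exp_neg_mul_atTop_nhds_zero k b hb).congr fun t => ?_
  rw [Real.rpow_natCast, expMonomial]

theorem tendsto_zero_of_mem_expKer {L : List ℝ} (hL : ∀ b ∈ L, 0 < b) {f : ℝ → ℝ}
    (hf : f ∈ expKer L) : Tendsto f atTop (𝓝 0) := by
  simpa using tendsto_div_of_mem_expKer hf (fun _ => 1) fun k b h => by
    simpa using tendsto_expMonomial k (hL b (List.count_pos_iff.1 (by omega)))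

/-- The leading monomial of `expKer (a :: L)`, where `a` is the least exponent, dominates
`expKer L`. -/
theorem tendsto_div_leading {a : ℝ} {L : List ℝ} (hL : ∀ b ∈ L, a ≤ b) {m : ℕ}
    (hm : m = L.count a) {f : ℝ → ℝ} (hf : f ∈ expKer L) :
    Tendsto (fun t => f t / expMonomial m a t) atTop (𝓝 0) := by
  refine tendsto_div_of_mem_expKer hf _ fun k b h => ?_
  rcases (hL b (List.count_pos_iff.1 (by omega))).eq_or_lt with rfl | hab
  · have hk : m - k ≠ 0 := by omega
    refine ((tendsto_pow_atTop hk).inv_tendsto_atTop (𝕜 := ℝ)).congr' ?_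
    filter_upwards [eventually_gt_atTop 0] with t ht
    have he := (Real.exp_pos (-a * t)).ne'
    simp only [expMonomial, Pi.inv_apply]
    rw [mul_div_mul_right _ _ he, eq_div_iff (by positivity), show m = (m - k) + k by omega,
      pow_add, Nat.add_sub_cancel]
    field_simp
  · refine squeeze_zero' ?_ ?_ (tendsto_expMonomial k (sub_pos.2 hab))
    · filter_upwards [eventually_gt_atTop 0] with t ht
      simp only [expMonomial]
      positivity
    · filter_upwards [eventually_ge_atTop 1] with t ht
      have h1 : (1 : ℝ) ≤ t ^ m := one_le_pow₀ ht
      have h2 : Real.exp (-b * t) = Real.exp (-(b - a) * t) * Real.exp (-a * t) := by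
        rw [← Real.exp_add]
        ring_nf
      simp only [expMonomial]
      rw [h2, div_le_iff₀ (by positivity)]
      have h3 : 0 ≤ t ^ k * Real.exp (-(b - a) * t) * Real.exp (-a * t) := by positivity
      nlinarith

theorem exists_leading_coeff {a : ℝ} {L : List ℝ} {m : ℕ} (hm : m = L.count a) {f : ℝ → ℝ}
    (hf : f ∈ expKer (a :: L)) : ∃ A : ℝ, f - A • expMonomial m a ∈ expKer L := by
  have hle : expMonomials (a :: L) ⊆ insert (expMonomial m a) (expMonomials L) := by
    rintro g ⟨k, b, h, rfl⟩
    by_cases hab : a = b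
    · subst hab
      rw [List.count_cons_self] at h
      rcases eq_or_ne k m with rfl | hk
      · exact mem_insert _ _
      · exact mem_insert_of_mem _ ⟨k, a, by omega, rfl⟩
    · rw [List.count_cons_of_ne (by simpa using hab)] at h
      exact mem_insert_of_mem _ ⟨k, b, h, rfl⟩
  rw [expKer_eq_span] at hf
  obtain ⟨A, g, hg, rfl⟩ := Submodule.mem_span_insert.1 (Submodule.span_mono hle hf)
  exact ⟨A, by simpa [expKer_eq_span] using hg⟩

/-! ### Sign counting with decay and a derivative condition -/

/-- This is Rolle's theorem on a half-line: a nonnegative function that tends to 0 cannot increase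
strictly forever. -/
theorem exists_deriv_sign_of_tendsto {f : ℝ → ℝ} (hf : Differentiable ℝ f)
    (hlim : Tendsto f atTop (𝓝 0)) {x σ : ℝ} (h : 0 ≤ σ * f x) :
    ∃ ξ, x < ξ ∧ σ * deriv f ξ ≤ 0 := by
  by_contra! hc
  have hmono : StrictMonoOn (fun t => σ * f t) (Ici x) := by
    refine strictMonoOn_of_deriv_pos (convex_Ici x)
      ((continuous_const.mul hf.continuous).continuousOn) fun t ht => ?_
    rw [interior_Ici] at ht
    rw [deriv_const_mul _ (hf t)]
    exact hc t ht
  have h1 : σ * f x < σ * f (x + 1) := hmono self_mem_Ici (by simp) (by linarith)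
  have h2 : σ * f (x + 1) ≤ σ * 0 := by
    refine ge_of_tendsto (hlim.const_mul σ) ?_
    filter_upwards [eventually_ge_atTop (x + 1)] with t ht
    exact hmono.monotoneOn (by simp) (mem_Ici.2 (by linarith)) ht
  linarith

/-- Alternation at `L.length` points, the function and its derivative being nonnegative at the
first of them. -/
theorem expKer_eq_zero_of_alternating_deriv {L : List ℝ} (hL : ∀ b ∈ L, 0 < b) {f : ℝ → ℝ}
    (hf : f ∈ expKer L) {k : ℕ} (hk : L.length = k + 1) (y : ℕ → ℝ)
    (hy : ∀ i < k, y i < y (i + 1)) (hs : ∀ i ≤ k, 0 ≤ (-1) ^ i * f (y i))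
    (hd : 0 ≤ deriv f (y 0)) : f = 0 := by
  have hdf := differentiable_of_mem_expKer hf
  have hlim := tendsto_zero_of_mem_expKer hL hf
  have key : ∀ i, ∃ ξ, i ≤ k → y i < ξ ∧ (i < k → ξ < y (i + 1)) ∧
      0 ≤ (-1) ^ (i + 1) * deriv f ξ := by
    intro i
    rcases lt_trichotomy i k with hi | hi | hi
    · obtain ⟨ξ, hξ, he⟩ := exists_deriv_eq_slope f (hy i hi) hdf.continuous.continuousOn
        hdf.differentiableOn
      refine ⟨ξ, fun _ => ⟨hξ.1, fun _ => hξ.2, ?_⟩⟩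
      have h0 := hs i hi.le
      have h1 := hs (i + 1) hi
      rw [he, ← mul_div_assoc]
      refine div_nonneg ?_ (sub_pos.2 (hy i hi)).le
      rw [pow_succ] at h1 ⊢
      linarith
    · obtain ⟨ξ, hξ, he⟩ := exists_deriv_sign_of_tendsto hdf hlim (hs i hi.le)
      refine ⟨ξ, fun _ => ⟨hξ, fun h => by omega, ?_⟩⟩
      rw [pow_succ]
      linarith
    · exact ⟨0, fun h => by omega⟩
  choose ξ hξ using key
  -- The derivative alternates at k + 2 points: y 0 by hypothesis, one point in each gap, and one
  -- beyond y k because of the decay.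
  have hz : deriv f = 0 := by
    refine expKer_eq_zero_of_alternating (deriv_mem_expKer hf)
      (fun i => if i = 0 then y 0 else ξ (i - 1)) ?_ ?_
    · intro i hi
      rcases i with _ | i
      · simpa using (hξ 0 (by omega)).1
      · simpa using ((hξ i (by omega)).2.1 (by omega)).trans (hξ (i + 1) (by omega)).1
    · intro i hi
      rcases i with _ | i
      · simpa using hd
      · simpa using (hξ i (by omega)).2.2
  have hconst : ∀ t, f t = f 0 := fun t =>
    is_const_of_deriv_eq_zero hdf (fun t => congrFun hz t) t 0
  have h0 : f 0 = 0 := tendsto_nhds_unique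
    (tendsto_const_nhds.congr fun t => (hconst t).symm) hlim
  funext t
  rw [hconst, h0]
  rfl

/-- The point a precedes all of `X` and shifts every parity by one, hence the inequality opposite to
the one in `expKer_eq_zero_of_sign`. -/
theorem expKer_eq_zero_of_sign_deriv {L : List ℝ} (hL : ∀ b ∈ L, 0 < b) {f : ℝ → ℝ}
    (hf : f ∈ expKer L) {a : ℝ} (X : Finset ℝ) (hX : X.card + 1 = L.length)
    (haX : ∀ x ∈ X, a < x) (h0 : 0 ≤ f a) (hd : 0 ≤ deriv f a)
    (hs : ∀ x ∈ X, f x * ∏ z ∈ X.erase x, (z - x) ≤ 0) : f = 0 := by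
  obtain ⟨x, hx, hxs⟩ := exists_increasing_enum X
  refine expKer_eq_zero_of_alternating_deriv hL hf hX.symm
    (fun i => if i = 0 then a else x (i - 1)) ?_ ?_ (by simpa using hd)
  · intro i hi
    rcases i with _ | i
    · simpa using haX _ (hxs 0 hi).1
    · simpa using hx i hi
  · intro i hi
    rcases i with _ | i
    · simpa using h0
    · obtain ⟨hm, hp⟩ := hxs i hi
      have h1 := hs _ hm
      simp only [Nat.add_eq_zero_iff, one_ne_zero, and_false, if_false, Nat.add_sub_cancel]
      set P := ∏ z ∈ X.erase (x i), (z - x i) with hP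
      have hP0 : P ≠ 0 := by
        intro h
        simp [h] at hp
      have h2 := mul_nonpos_of_nonpos_of_nonneg h1 hp.le
      refine nonneg_of_mul_nonneg_left (b := P ^ 2) ?_ (by positivity)
      rw [pow_succ]
      linarith

/-- Zeros at `Z` and a sign at a further point. -/
theorem expKer_eq_zero_of_zeros_sign_deriv {L : List ℝ} (hL : ∀ b ∈ L, 0 < b) {f : ℝ → ℝ}
    (hf : f ∈ expKer L) {a : ℝ} (Z : Finset ℝ) (hZ : Z.card + 2 = L.length)
    (haZ : ∀ z ∈ Z, a < z) (hz : ∀ z ∈ Z, f z = 0) (h0 : 0 ≤ f a) (hd : 0 ≤ deriv f a)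
    {M : ℝ} (haM : a < M) (hMZ : M ∉ Z) (hM : f M * ∏ z ∈ Z, (z - M) ≤ 0) : f = 0 := by
  refine expKer_eq_zero_of_sign_deriv hL hf (insert M Z) ?_ ?_ h0 hd fun x hx => ?_
  · rw [Finset.card_insert_of_notMem hMZ]
    omega
  · intro x hx
    rcases Finset.mem_insert.1 hx with rfl | hx
    · exact haM
    · exact haZ x hx
  · rcases Finset.mem_insert.1 hx with rfl | hx
    · rwa [Finset.erase_insert hMZ]
    · simp [hz x hx]

/-- As with simple zeros, the sign at one extra point is right for f or for -f. -/
theorem expKer_eq_zero_of_double_zero {L : List ℝ} (hL : ∀ b ∈ L, 0 < b) {f : ℝ → ℝ}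
    (hf : f ∈ expKer L) {a : ℝ} (Z : Finset ℝ) (hZ : Z.card + 2 = L.length)
    (haZ : ∀ z ∈ Z, a < z) (hz : ∀ z ∈ Z, f z = 0) (h0 : f a = 0) (hd : deriv f a = 0) :
    f = 0 := by
  obtain ⟨M, haM, hMZ⟩ : ∃ M, a < M ∧ M ∉ Z :=
    (Ioi_infinite a).exists_notMem_finset Z
  rcases le_total (f M * ∏ z ∈ Z, (z - M)) 0 with h | h
  · exact expKer_eq_zero_of_zeros_sign_deriv hL hf Z hZ haZ hz h0.ge hd.ge haM hMZ h
  · refine neg_eq_zero.1 (expKer_eq_zero_of_zeros_sign_deriv hL ((expKer L).neg_mem hf) Z hZ haZ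
      (fun z h => by simp [hz z h]) (by simp [h0]) ?_ haM hMZ (by simpa using h))
    rw [deriv.neg]
    simp [hd]

/-! ### Prescribed sign changes and separation of extremal points -/

/-- Prescribing the value at one point off `W` fixes the sign everywhere, because all admissible
zeros are used up. -/
theorem exists_expKer_sign {L : List ℝ} (W : Finset ℝ) (hW : W.card + 1 = L.length) :
    ∃ g ∈ expKer L, (∀ w ∈ W, g w = 0) ∧ ∀ t ∉ W, 0 < g t * ∏ w ∈ W, (w - t) := by
  obtain ⟨M, hM⟩ := Infinite.exists_notMem_finset W
  obtain ⟨g, hg, hgX⟩ := exists_expKer_interpolation (L := L) (insert M W)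
    (by rw [Finset.card_insert_of_notMem hM, hW]) (fun t => if t = M then ∏ w ∈ W, (w - M) else 0)
  have hP : ∏ w ∈ W, (w - M) ≠ 0 :=
    Finset.prod_ne_zero_iff.2 fun w hw h => hM (sub_eq_zero.1 h ▸ hw)
  have hgM : g M = ∏ w ∈ W, (w - M) := by simpa using hgX M (Finset.mem_insert_self _ _)
  have hgW : ∀ w ∈ W, g w = 0 := fun w hw => by
    rw [hgX w (Finset.mem_insert_of_mem hw), if_neg]
    rintro rfl
    exact hM hw
  have hg0 : g ≠ 0 := by
    rintro rfl
    exact hP hgM.symm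
  refine ⟨g, hg, hgW, fun t ht => ?_⟩
  have := expKer_sign_of_zeros hg hg0 W hW hgW ht hM
  rw [hgM] at this
  exact pos_of_mul_pos_left this (mul_self_nonneg _)

theorem exists_bound_lt_one {f : ℝ → ℝ} (hf : Continuous f) (hlim : Tendsto f atTop (𝓝 0))
    {C : Set ℝ} (hC : IsClosed C) (hC0 : C ⊆ Ici 0) (h1 : ∀ t ∈ C, |f t| < 1) :
    ∃ ρ, 0 < ρ ∧ ρ < 1 ∧ ∀ t ∈ C, |f t| ≤ ρ := by
  obtain ⟨T, hT⟩ : ∃ T, ∀ t ≥ T, |f t| < 1 / 2 := by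
    have := (hlim.abs).eventually (gt_mem_nhds (show |(0 : ℝ)| < 1 / 2 by norm_num))
    exact eventually_atTop.1 this
  have hcomp : IsCompact (C ∩ Icc 0 T) := isCompact_Icc.inter_left hC
  rcases (C ∩ Icc 0 T).eq_empty_or_nonempty with he | hne
  · refine ⟨1 / 2, by norm_num, by norm_num, fun t ht => ?_⟩
    by_cases h : t ≤ T
    · exact absurd (show t ∈ C ∩ Icc 0 T from ⟨ht, hC0 ht, h⟩) (by simp [he])
    · exact (hT t (not_le.1 h).le).le
  · obtain ⟨x, hx, hmax⟩ := hcomp.exists_isMaxOn hne hf.abs.continuousOn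
    refine ⟨max (1 / 2) |f x|, by positivity, max_lt (by norm_num) (h1 x hx.1), fun t ht => ?_⟩
    by_cases h : t ≤ T
    · exact le_max_of_le_right (hmax ⟨ht, hC0 ht, h⟩)
    · exact le_max_of_le_left (hT t (not_le.1 h).le).le

theorem exists_abs_bound {f : ℝ → ℝ} (hf : Continuous f) (hlim : Tendsto f atTop (𝓝 0)) :
    ∃ B, 0 < B ∧ ∀ t, 0 ≤ t → |f t| ≤ B := by
  obtain ⟨T, hT⟩ : ∃ T, ∀ t ≥ T, |f t| < 1 := by
    have := (hlim.abs).eventually (gt_mem_nhds (show |(0 : ℝ)| < 1 by norm_num))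
    exact eventually_atTop.1 this
  obtain ⟨B, hB⟩ := isCompact_Icc.exists_bound_of_continuousOn (s := Icc 0 T) hf.continuousOn
  refine ⟨max 1 B, by positivity, fun t ht => ?_⟩
  by_cases h : t ≤ T
  · exact le_max_of_le_right (hB t ⟨ht, h⟩)
  · exact le_max_of_le_left (hT t (not_le.1 h).le).le

/-- The points where `|p| = 1` either contain a long alternation or their signs are separated by
few points. -/
theorem exists_separating {p : ℝ → ℝ} (hp : Continuous p) : ∀ (k : ℕ) (a s : ℝ), |s| = 1 →
    p a ≠ s →
    (¬ ∃ y : ℕ → ℝ, (∀ i ≤ k, a < y i) ∧ (∀ i < k, y i < y (i + 1)) ∧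
      ∀ i ≤ k, p (y i) = s * (-1) ^ i) →
    ∃ W : Finset ℝ, W.card ≤ k ∧ (∀ w ∈ W, a < w) ∧
      ∀ y, a ≤ y → |p y| = 1 → y ∉ W ∧ p y * s * ∏ w ∈ W, (w - y) < 0 := by
  intro k
  induction k with
  | zero =>
    intro a s hs ha h
    refine ⟨∅, by simp, by simp, fun y hy hpy => ⟨by simp, ?_⟩⟩
    have hne : p y ≠ s := by
      intro he
      rcases hy.eq_or_lt with rfl | hlt
      · exact ha he
      · exact h ⟨fun _ => y, by simp [hlt], by simp, by simp [he]⟩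
    rw [Finset.prod_empty, mul_one]
    rcases eq_or_eq_neg_of_abs_eq hs with rfl | rfl <;>
    rcases eq_or_eq_neg_of_abs_eq hpy with h1 | h1 <;> simp_all
  | succ k ih =>
    intro a s hs ha h
    have hss : s * s = 1 := by
      rw [← abs_mul_abs_self, hs, mul_one]
    have hopp : ∀ y, |p y| = 1 → p y ≠ s → p y = -s := by
      intro y hy hne
      rcases eq_or_eq_neg_of_abs_eq hs with rfl | rfl <;>
      rcases eq_or_eq_neg_of_abs_eq hy with h1 | h1 <;> simp_all
    by_cases hex : ∃ y, a ≤ y ∧ p y = s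
    · have hcl : IsClosed {y | a ≤ y ∧ p y = s} :=
        isClosed_Ici.inter (isClosed_eq hp continuous_const)
      have hbd : BddBelow {y | a ≤ y ∧ p y = s} := ⟨a, fun y hy => hy.1⟩
      obtain ⟨haw, hpw⟩ := hcl.csInf_mem hex hbd
      have hinf : ∀ y, a ≤ y → p y = s → sInf {y | a ≤ y ∧ p y = s} ≤ y :=
        fun y h1 h2 => csInf_le hbd ⟨h1, h2⟩
      set v := sInf {y | a ≤ y ∧ p y = s} with hv
      have hav : a < v := lt_of_le_of_ne haw (by rintro he; exact ha (he ▸ hpw))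
      have hnear : ∀ᶠ y in 𝓝[<] v, 0 < p y * s := by
        refine nhdsWithin_le_nhds (((hp.mul continuous_const).tendsto v).eventually
          (lt_mem_nhds ?_))
        show 0 < p v * s
        rw [hpw, hss]
        exact one_pos
      obtain ⟨u, huv, hu⟩ := (mem_nhdsLT_iff_exists_Ioo_subset).1 hnear
      -- The separating point w lies just to the left of v, the first point where p = s. No extremal
      -- point lies in [w, v), so the search restarts at w with the opposite sign.
      obtain ⟨w, hw1, hw2⟩ := exists_between (max_lt huv hav)
      have huw := lt_of_le_of_lt (le_max_left _ _) hw1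
      have haw := lt_of_le_of_lt (le_max_right _ _) hw1
      have hpos : ∀ y, w ≤ y → y ≤ v → 0 < p y * s := by
        intro y h1 h2
        rcases h2.eq_or_lt with rfl | h2
        · rw [hpw, hss]
          exact one_pos
        · exact hu ⟨huw.trans_le h1, h2⟩
      have hpw1 : ∀ y, w ≤ y → y ≤ v → p y ≠ -s := by
        intro y h1 h2 h3
        have := hpos y h1 h2
        rw [h3] at this
        linarith
      obtain ⟨W, hWc, hW, hWs⟩ := ih w (-s) (by rwa [abs_neg]) (hpw1 w le_rfl hw2.le) (by
        rintro ⟨y, hy1, hy2, hy3⟩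
        have hvy : v < y 0 := by
          by_contra! hc
          exact hpw1 (y 0) (hy1 0 (by omega)).le hc (by simpa using hy3 0 (by omega))
        refine h ⟨fun i => if i = 0 then v else y (i - 1), ?_, ?_, ?_⟩
        · intro i hi
          rcases i with _ | i
          · simpa using hav
          · simpa using haw.trans (hy1 i (by omega))
        · intro i hi
          rcases i with _ | i
          · simpa using hvy
          · simpa using hy2 i (by omega)
        · intro i hi
          rcases i with _ | i
          · simpa using hpw
          · simp only [Nat.add_eq_zero_iff, one_ne_zero, and_false, if_false, Nat.add_sub_cancel]
            rw [hy3 i (by omega), pow_succ]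
            ring)
      have hwW : w ∉ W := fun h => lt_irrefl _ (hW w h)
      refine ⟨insert w W, ?_, ?_, ?_⟩
      · rw [Finset.card_insert_of_notMem hwW]
        omega
      · intro x hx
        rcases Finset.mem_insert.1 hx with rfl | hx
        · exact haw
        · exact haw.trans (hW x hx)
      · intro y hay hy
        rcases lt_or_ge y w with hyw | hyw
        · have hps : p y = -s := hopp y hy fun he =>
            absurd (hinf y hay he) (not_le.2 (hyw.trans hw2))
          refine ⟨fun hm => ?_, ?_⟩
          · rcases Finset.mem_insert.1 hm with rfl | hm
            · exact lt_irrefl _ hyw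
            · exact lt_irrefl _ ((hW y hm).trans hyw)
          · have hP : 0 < ∏ z ∈ insert w W, (z - y) := by
              refine Finset.prod_pos fun z hz => sub_pos.2 ?_
              rcases Finset.mem_insert.1 hz with rfl | hz
              · exact hyw
              · exact hyw.trans (hW z hz)
            rw [hps, neg_mul, hss]
            linarith
        · obtain ⟨h1, h2⟩ := hWs y hyw hy
          have hne : y ≠ w := by
            rintro rfl
            have h3 : p y ≠ s := fun he => absurd (hinf y haw.le he) (not_le.2 hw2)
            exact hpw1 y le_rfl hw2.le (hopp y hy h3)
          refine ⟨by simp [hne, h1], ?_⟩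
          rw [Finset.prod_insert hwW]
          have h3 : 0 < y - w := sub_pos.2 (lt_of_le_of_ne hyw hne.symm)
          have := mul_neg_of_neg_of_pos h2 h3
          linarith
    · refine ⟨∅, by simp, by simp, fun y hy hpy => ⟨by simp, ?_⟩⟩
      rw [hopp y hpy fun he => hex ⟨y, hy, he⟩, Finset.prod_empty, mul_one, neg_mul, hss]
      norm_num

theorem exists_zeros_of_alternating {p : ℝ → ℝ} (hp : Continuous p) (k : ℕ) (y : ℕ → ℝ)
    (hy : ∀ i < k, y i < y (i + 1)) (hs : ∀ i < k, p (y i) * p (y (i + 1)) < 0) :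
    ∃ Z : Finset ℝ, Z.card = k ∧ ∀ z ∈ Z, y 0 < z ∧ p z = 0 := by
  have key : ∀ i, ∃ z, i < k → y i < z ∧ z < y (i + 1) ∧ p z = 0 := by
    intro i
    by_cases hi : i < k
    · have h0 := hs i hi
      rcases mul_neg_iff.1 h0 with ⟨h1, h2⟩ | ⟨h1, h2⟩
      · obtain ⟨z, hz, he⟩ := intermediate_value_Ioo' (hy i hi).le hp.continuousOn
          (show (0 : ℝ) ∈ _ from ⟨h2, h1⟩)
        exact ⟨z, fun _ => ⟨hz.1, hz.2, he⟩⟩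
      · obtain ⟨z, hz, he⟩ := intermediate_value_Ioo (hy i hi).le hp.continuousOn
          (show (0 : ℝ) ∈ _ from ⟨h1, h2⟩)
        exact ⟨z, fun _ => ⟨hz.1, hz.2, he⟩⟩
    · exact ⟨0, fun h => absurd h hi⟩
  choose z hz using key
  have hmono : ∀ i j, i < j → j < k → z i < z j := by
    intro i j hij
    induction j, hij using Nat.le_induction with
    | base => exact fun hj => (hz i (by omega)).2.1.trans (hz (i + 1) hj).1
    | succ j hj ih =>
      exact fun hk => (ih (by omega)).trans ((hz j (by omega)).2.1.trans (hz (j + 1) hk).1)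
  refine ⟨(Finset.range k).image z, ?_, ?_⟩
  · rw [Finset.card_image_of_injOn, Finset.card_range]
    intro i hi j hj hij
    simp only [Finset.coe_range, mem_Iio] at hi hj
    rcases lt_trichotomy i j with h | h | h
    · exact absurd hij (hmono i j h hj).ne
    · exact h
    · exact absurd hij (hmono j i h hi).ne'
  · intro w hw
    obtain ⟨i, hi, rfl⟩ := Finset.mem_image.1 hw
    rw [Finset.mem_range] at hi
    refine ⟨?_, (hz i hi).2.2⟩
    rcases Nat.eq_zero_or_pos i with rfl | h
    · exact (hz 0 hi).1
    · exact (hz 0 (by omega)).1.trans (hmono 0 i h hi)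

/-! ### The extremal problem and existence of a solution -/

/-- The feasible set of the extremal problem, for a list of exponents. -/
def expFeasible (L : List ℝ) (ε : ℝ) : Set (ℝ → ℝ) :=
  {p | p ∈ expKer L ∧ (∀ t, 0 ≤ t → |p t| ≤ 1) ∧ ε * p 0 < deriv p 0}

/-- Optimal elements of the extremal problem, for a list of exponents. -/
def IsExpOptimal (L : List ℝ) (ε : ℝ) (p : ℝ → ℝ) : Prop :=
  p ∈ expFeasible L ε ∧ ∀ q ∈ expFeasible L ε, objective ε p ≤ objective ε q

/-- The indices carrying an exponent b, taken in increasing order, have 0, 1, 2, … predecessors with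
the same exponent, so they produce exactly the powers below the multiplicity. -/
theorem expPoly_eq_expKer {d : ℕ} (h : Fin d → ℝ) : expPoly h = expKer (List.ofFn h) := by
  have hcount : ∀ b, (List.ofFn h).count b = (Finset.univ.filter (fun j => h j = b)).card := by
    intro b
    induction d with
    | zero => simp
    | succ d ih =>
      rw [List.ofFn_succ, List.count_cons, ih (fun i => h i.succ), Fin.card_filter_univ_succ]
      by_cases hb : h 0 = b <;> simp [hb]
  rw [expKer_eq_span, expPoly]
  congr 1
  ext f
  constructor
  · rintro ⟨i, rfl⟩
    refine ⟨_, h i, ?_, rfl⟩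
    rw [hcount]
    refine Finset.card_lt_card ⟨fun j hj => by simp_all, fun hc => ?_⟩
    have := hc (show i ∈ Finset.univ.filter (fun j => h j = h i) by simp)
    simp at this
  · rintro ⟨k, b, hk, rfl⟩
    rw [hcount] at hk
    set s := Finset.univ.filter (fun j => h j = b) with hs
    let e := s.orderEmbOfFin rfl
    have he : ∀ i, h (e i) = b := fun i =>
      (Finset.mem_filter.1 (s.orderEmbOfFin_mem rfl i)).2
    have hi := he ⟨k, hk⟩
    refine ⟨e ⟨k, hk⟩, ?_⟩
    have hc : (Finset.univ.filter
        (fun j : Fin d => j < e ⟨k, hk⟩ ∧ h j = h (e ⟨k, hk⟩))).card = k := by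
      have : Finset.univ.filter (fun j : Fin d => j < e ⟨k, hk⟩ ∧ h j = h (e ⟨k, hk⟩)) =
          (Finset.Iio (⟨k, hk⟩ : Fin s.card)).map e.toEmbedding := by
        ext j
        simp only [Finset.mem_filter, Finset.mem_univ, true_and, Finset.mem_map, Finset.mem_Iio]
        constructor
        · rintro ⟨h1, h2⟩
          have hj : j ∈ s := by
            rw [hs, Finset.mem_filter]
            exact ⟨Finset.mem_univ _, h2.trans hi⟩
          rw [← Finset.mem_coe, ← s.range_orderEmbOfFin rfl] at hj
          obtain ⟨i, rfl⟩ := hj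
          exact ⟨i, e.lt_iff_lt.1 h1, rfl⟩
        · rintro ⟨i, h1, rfl⟩
          exact ⟨e.lt_iff_lt.2 h1, (he i).trans hi.symm⟩
      rw [this, Finset.card_map, Fin.card_Iio]
    unfold expBasis
    rw [hc, hi]
    rfl

theorem le_halfLineNorm {p : ℝ → ℝ} {B : ℝ} (hB : ∀ t, 0 ≤ t → |p t| ≤ B) {t : ℝ} (ht : 0 ≤ t) :
    |p t| ≤ halfLineNorm p :=
  le_ciSup (f := fun t : Ici (0 : ℝ) => |p t|) ⟨B, by rintro _ ⟨s, rfl⟩; exact hB s s.2⟩ ⟨t, ht⟩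

theorem halfLineNorm_le {p : ℝ → ℝ} {B : ℝ} (hB : ∀ t, 0 ≤ t → |p t| ≤ B) :
    halfLineNorm p ≤ B :=
  ciSup_le fun t => hB t t.2

theorem halfLineNorm_le_one_iff {L : List ℝ} (hL : ∀ b ∈ L, 0 < b) {p : ℝ → ℝ}
    (hp : p ∈ expKer L) : halfLineNorm p ≤ 1 ↔ ∀ t, 0 ≤ t → |p t| ≤ 1 := by
  refine ⟨fun h t ht => ?_, halfLineNorm_le⟩
  obtain ⟨B, -, hB⟩ := exists_abs_bound (differentiable_of_mem_expKer hp).continuous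
    (tendsto_zero_of_mem_expKer hL hp)
  exact (le_halfLineNorm hB ht).trans h

theorem feasible_eq {d : ℕ} {h : Fin d → ℝ} (hh : ∀ i, 0 < h i) (ε : ℝ) :
    feasible h ε = expFeasible (List.ofFn h) ε := by
  ext p
  simp only [feasible, expFeasible, mem_ofPred_eq, expPoly_eq_expKer]
  refine and_congr_right fun hp => and_congr_left fun _ => ?_
  exact halfLineNorm_le_one_iff (fun b hb => by obtain ⟨i, rfl⟩ := List.mem_ofFn.1 hb; exact hh i) hp

theorem deriv_nonpos_of_forall_le {p : ℝ → ℝ} (hd : DifferentiableAt ℝ p 0)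
    (hb : ∀ t, 0 ≤ t → p t ≤ p 0) : deriv p 0 ≤ 0 := by
  have h1 : Tendsto (slope p 0) (𝓝[>] 0) (𝓝 (deriv p 0)) :=
    (hasDerivAt_iff_tendsto_slope.1 hd.hasDerivAt).mono_left
      (nhdsWithin_mono _ fun t ht => (ne_of_gt ht : t ≠ 0))
  refine le_of_tendsto h1 ?_
  filter_upwards [self_mem_nhdsWithin] with t ht
  have ht : 0 < t := ht
  rw [slope_def_field]
  exact div_nonpos_of_nonpos_of_nonneg (sub_nonpos.2 (hb t ht.le)) (by linarith)

/-- If p(0) = 1, then 0 is a maximum on the half-line and p'(0) ≤ 0 < ε. The weak inequality in `hd`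
is what the compactness argument needs. -/
theorem apply_zero_lt_one {L : List ℝ} {p : ℝ → ℝ} (hp : p ∈ expKer L)
    (hb : ∀ t, 0 ≤ t → |p t| ≤ 1) {ε : ℝ} (hε : 0 < ε) (hd : ε * p 0 ≤ deriv p 0) : p 0 < 1 := by
  refine lt_of_le_of_ne (le_of_abs_le (hb 0 le_rfl)) fun h => ?_
  have := deriv_nonpos_of_forall_le (differentiable_of_mem_expKer hp 0)
    fun t ht => by rw [h]; exact le_of_abs_le (hb t ht)
  rw [h] at hd
  linarith

theorem expFeasible_nonempty {L : List ℝ} (hL : ∀ b ∈ L, 0 < b) (hL0 : L ≠ []) {ε : ℝ}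
    (hε : 0 < ε) : (expFeasible L ε).Nonempty := by
  obtain ⟨a, L, rfl⟩ := List.exists_cons_of_ne_nil hL0
  have ha : 0 < a := hL a (by simp)
  refine ⟨-expMonomial 0 a, (expKer _).neg_mem (expMonomial_mem_expKer (by simp)), fun t ht => ?_, ?_⟩
  · rw [Pi.neg_apply, abs_neg]
    simp only [expMonomial, pow_zero, one_mul, Real.abs_exp]
    exact Real.exp_le_one_iff.2 (by nlinarith)
  · rw [deriv.neg, (hasDerivAt_expMonomial 0 a 0).deriv]
    simp [expMonomial]
    linarith

/-- The extremal problem has a solution. -/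
theorem exists_isExpOptimal {L : List ℝ} (hL : ∀ b ∈ L, 0 < b) (hL0 : L ≠ []) {ε : ℝ}
    (hε : 0 < ε) : ∃ p, IsExpOptimal L ε p := by
  obtain ⟨p₀, hp₀⟩ := expFeasible_nonempty hL hL0 hε
  obtain ⟨X, hX0, hXc⟩ := (Ici_infinite (0 : ℝ)).exists_subset_card_eq L.length
  let φ : expKer L →ₗ[ℝ] (X → ℝ) :=
    { toFun := fun f x => f.1 x
      map_add' := fun _ _ => rfl
      map_smul' := fun _ _ => rfl }
  have hφ : ∀ f, φ f = 0 → f = 0 := fun f hf => Subtype.ext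
    (expKer_eq_zero_of_zeros f.2 X hXc fun x hx => congrFun hf ⟨x, hx⟩)
  let Φ : expKer L ≃ₗ[ℝ] (X → ℝ) := LinearEquiv.ofBijective φ
    ⟨(injective_iff_map_eq_zero φ).2 hφ,
      expKer_surjective_of_injective (by simpa using hXc) φ hφ⟩
  let ev : ℝ → (X → ℝ) →ₗ[ℝ] ℝ := fun t =>
    { toFun := fun v => (Φ.symm v).1 t
      map_add' := fun v w => by simp
      map_smul' := fun c v => by simp }
  let dv : (X → ℝ) →ₗ[ℝ] ℝ :=
    { toFun := fun v => deriv (Φ.symm v).1 0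
      map_add' := fun v w => by
        rw [map_add, Submodule.coe_add]
        exact deriv_add (differentiable_of_mem_expKer (Φ.symm v).2 0)
          (differentiable_of_mem_expKer (Φ.symm w).2 0)
      map_smul' := fun c v => by
        rw [map_smul, Submodule.coe_smul]
        exact deriv_const_smul c (differentiable_of_mem_expKer (Φ.symm v).2 0) }
  have hev : ∀ t, Continuous (ev t) := fun t => (ev t).continuous_of_finiteDimensional
  have hdv : Continuous dv := dv.continuous_of_finiteDimensional
  set c := objective ε p₀ with hc
  -- These are closed conditions for being feasible and no worse than `p₀`. The denominator is only
  -- required to be nonnegative, but `hden` shows that it cannot vanish. Values at the points of `X`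
  -- serve as coordinates, so the norm bound makes `K` bounded.
  let K : Set (X → ℝ) := {v | (∀ t, 0 ≤ t → |ev t v| ≤ 1) ∧
    1 - ev 0 v ≤ c * (dv v - ε * ev 0 v) ∧ 0 ≤ dv v - ε * ev 0 v}
  have hden : ∀ v ∈ K, 0 < dv v - ε * ev 0 v := by
    rintro v ⟨h1, h2, h3⟩
    refine lt_of_le_of_ne h3 fun h => ?_
    have h4 : ev 0 v < 1 := apply_zero_lt_one (Φ.symm v).2 h1 hε (sub_nonneg.1 h3)
    rw [← h, mul_zero] at h2
    linarith
  have hKcl : IsClosed K := by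
    refine IsClosed.inter ?_ (IsClosed.inter ?_ ?_)
    · have : {v : X → ℝ | ∀ t, 0 ≤ t → |ev t v| ≤ 1} =
          ⋂ t : ℝ, ⋂ _ : 0 ≤ t, {v | |ev t v| ≤ 1} := by
        ext v
        simp
      change IsClosed {v : X → ℝ | ∀ t, 0 ≤ t → |ev t v| ≤ 1}
      rw [this]
      exact isClosed_iInter fun t => isClosed_iInter fun _ =>
        isClosed_le (hev t).abs continuous_const
    · exact isClosed_le (continuous_const.sub (hev 0))
        (continuous_const.mul (hdv.sub (continuous_const.mul (hev 0))))
    · exact isClosed_le continuous_const (hdv.sub (continuous_const.mul (hev 0)))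
  have hKc : IsCompact K := by
    refine (isCompact_closedBall (0 : X → ℝ) 1).of_isClosed_subset hKcl fun v hv => ?_
    rw [mem_closedBall_zero_iff, pi_norm_le_iff_of_nonneg zero_le_one]
    intro x
    have h1 : ev x v = v x := congrFun (Φ.apply_symm_apply v) x
    rw [Real.norm_eq_abs, ← h1]
    exact hv.1 x (hX0 x.2)
  have hmem : ∀ q (hq : q ∈ expFeasible L ε), objective ε q ≤ c →
      Φ ⟨q, hq.1⟩ ∈ K := by
    intro q hq hqc
    have hs : Φ.symm (Φ ⟨q, hq.1⟩) = ⟨q, hq.1⟩ := Φ.symm_apply_apply _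
    have he : ∀ t, ev t (Φ ⟨q, hq.1⟩) = q t := fun t => by
      show (Φ.symm (Φ ⟨q, hq.1⟩)).1 t = _
      rw [hs]
    have hd : dv (Φ ⟨q, hq.1⟩) = deriv q 0 := by
      show deriv (Φ.symm (Φ ⟨q, hq.1⟩)).1 0 = _
      rw [hs]
    have hpos : 0 < deriv q 0 - ε * q 0 := sub_pos.2 hq.2.2
    refine ⟨fun t ht => by rw [he]; exact hq.2.1 t ht, ?_, ?_⟩
    · rw [hd, he]
      exact (div_le_iff₀ hpos).1 hqc
    · rw [hd, he]
      exact hpos.le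
  have hcont : ContinuousOn (fun v => (1 - ev 0 v) / (dv v - ε * ev 0 v)) K :=
    (continuous_const.sub (hev 0)).continuousOn.div
      (hdv.sub (continuous_const.mul (hev 0))).continuousOn fun v hv => (hden v hv).ne'
  obtain ⟨v, hv, hmin⟩ := hKc.exists_isMinOn ⟨_, hmem p₀ hp₀ le_rfl⟩ hcont
  have hvf : (Φ.symm v).1 ∈ expFeasible L ε := ⟨(Φ.symm v).2, hv.1, sub_pos.1 (hden v hv)⟩
  refine ⟨(Φ.symm v).1, hvf, fun q hq => ?_⟩
  have hle : objective ε (Φ.symm v).1 ≤ c := (div_le_iff₀ (hden v hv)).2 hv.2.1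
  rcases le_total (objective ε q) c with h | h
  · have h1 := hmin (hmem q hq h)
    have hs : Φ.symm (Φ ⟨q, hq.1⟩) = ⟨q, hq.1⟩ := Φ.symm_apply_apply _
    have h2 : (1 - ev 0 (Φ ⟨q, hq.1⟩)) / (dv (Φ ⟨q, hq.1⟩) - ε * ev 0 (Φ ⟨q, hq.1⟩)) =
        objective ε q := by
      show (1 - (Φ.symm (Φ ⟨q, hq.1⟩)).1 0) / (deriv (Φ.symm (Φ ⟨q, hq.1⟩)).1 0 -
        ε * (Φ.symm (Φ ⟨q, hq.1⟩)).1 0) = _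
      rw [hs]
      rfl
    exact h1.trans_eq h2
  · exact hle.trans h

/-! ### Linearisation, alternation and uniqueness -/

/-- The linear functional whose norm on `expKer L` equals one exactly when `κ` is the value of the
extremal problem. -/
noncomputable def dualFunctional (κ ε : ℝ) (p : ℝ → ℝ) : ℝ := κ * deriv p 0 + (1 - κ * ε) * p 0

theorem objective_pos {L : List ℝ} {ε : ℝ} (hε : 0 < ε) {p : ℝ → ℝ} (hp : p ∈ expFeasible L ε) :
    0 < objective ε p :=
  div_pos (sub_pos.2 (apply_zero_lt_one hp.1 hp.2.1 hε hp.2.2.le)) (sub_pos.2 hp.2.2)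

theorem dualFunctional_eq_one {L : List ℝ} {ε : ℝ} {p : ℝ → ℝ}
    (hp : p ∈ expFeasible L ε) : dualFunctional (objective ε p) ε p = 1 := by
  have hpos : 0 < deriv p 0 - ε * p 0 := sub_pos.2 hp.2.2
  have : objective ε p * (deriv p 0 - ε * p 0) = 1 - p 0 := div_mul_cancel₀ _ hpos.ne'
  unfold dualFunctional
  linarith

/-- Clearing the positive denominator gives the bound on feasible elements. On the others the κ-term
is nonpositive and q(0) ≤ 1 suffices. -/
theorem IsExpOptimal.dualFunctional_le {L : List ℝ} {ε : ℝ} (hε : 0 < ε) {p q : ℝ → ℝ}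
    (hp : IsExpOptimal L ε p) (hq : q ∈ expKer L) (hb : ∀ t, 0 ≤ t → |q t| ≤ 1) :
    dualFunctional (objective ε p) ε q ≤ 1 := by
  have h0 := objective_pos hε hp.1
  have h1 : q 0 ≤ 1 := le_of_abs_le (hb 0 le_rfl)
  unfold dualFunctional
  rcases lt_or_ge (ε * q 0) (deriv q 0) with h | h
  · have h2 := hp.2 q ⟨hq, hb, h⟩
    have := (le_div_iff₀ (sub_pos.2 h)).1 h2
    linarith
  · have := mul_nonneg h0.le (sub_nonneg.2 h)
    linarith

theorem isExpOptimal_of_dualFunctional_eq {L : List ℝ} {ε : ℝ} (hε : 0 < ε) {p q : ℝ → ℝ}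
    (hp : IsExpOptimal L ε p) (hq : q ∈ expKer L) (hb : ∀ t, 0 ≤ t → |q t| ≤ 1)
    (h : dualFunctional (objective ε p) ε q = 1) :
    IsExpOptimal L ε q ∧ objective ε q = objective ε p := by
  have h0 := objective_pos hε hp.1
  have h1 : q 0 ≤ 1 := le_of_abs_le (hb 0 le_rfl)
  have he : objective ε p * (deriv q 0 - ε * q 0) = 1 - q 0 := by
    unfold dualFunctional at h
    linarith
  have hge : ε * q 0 ≤ deriv q 0 := by
    by_contra! hc
    have := mul_neg_of_pos_of_neg h0 (sub_neg.2 hc)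
    linarith
  have hlt := apply_zero_lt_one hq hb hε hge
  have hpos : 0 < deriv q 0 - ε * q 0 := by
    by_contra! hc
    have := mul_nonpos_of_nonneg_of_nonpos h0.le hc
    linarith
  have hobj : objective ε q = objective ε p := by
    rw [objective, ← he, mul_div_cancel_right₀ _ hpos.ne']
  exact ⟨⟨⟨hq, hb, sub_pos.1 hpos⟩, fun r hr => hobj ▸ hp.2 r hr⟩, hobj⟩

/-- Kolmogorov's criterion: no direction that improves the functional is opposite to an optimal
element at all its extremal points. -/
theorem IsExpOptimal.exists_extremal {L : List ℝ} (hL : ∀ b ∈ L, 0 < b) {ε : ℝ} (hε : 0 < ε)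
    {p f : ℝ → ℝ} (hp : IsExpOptimal L ε p) (hf : f ∈ expKer L)
    (hpos : 0 < dualFunctional (objective ε p) ε f) :
    ∃ t, 0 ≤ t ∧ |p t| = 1 ∧ 0 ≤ f t * p t := by
  by_contra! hc
  have hpc := (differentiable_of_mem_expKer hp.1.1).continuous
  have hfc := (differentiable_of_mem_expKer hf).continuous
  -- Where f does not oppose p, the modulus of p stays below some ρ < 1, which leaves room for a
  -- small multiple of f; elsewhere adding it moves p towards 0 by at most 1.
  obtain ⟨ρ, hρ0, hρ1, hρ⟩ := exists_bound_lt_one hpc (tendsto_zero_of_mem_expKer hL hp.1.1)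
    (C := {t | 0 ≤ t ∧ 0 ≤ f t * p t})
    (isClosed_Ici.inter (isClosed_le continuous_const (hfc.mul hpc))) (fun t ht => ht.1)
    (fun t ht => lt_of_le_of_ne (hp.1.2.1 t ht.1) fun h => absurd ht.2 (not_le.2 (hc t ht.1 h)))
  obtain ⟨B, hB0, hB⟩ := exists_abs_bound hfc (tendsto_zero_of_mem_expKer hL hf)
  set δ := (1 - ρ) / B with hδ
  have hδ0 : 0 < δ := div_pos (by linarith) hB0
  have hδB : δ * B = 1 - ρ := div_mul_cancel₀ _ hB0.ne'
  have hle := hp.dualFunctional_le hε (q := p + δ • f)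
    ((expKer L).add_mem hp.1.1 ((expKer L).smul_mem _ hf)) (fun t ht => by
      simp only [Pi.add_apply, Pi.smul_apply, smul_eq_mul]
      have h1 : |δ * f t| ≤ 1 - ρ := by
        rw [abs_mul, abs_of_pos hδ0, ← hδB]
        exact mul_le_mul_of_nonneg_left (hB t ht) hδ0.le
      by_cases hs : 0 ≤ f t * p t
      · calc |p t + δ * f t| ≤ |p t| + |δ * f t| := abs_add_le _ _
          _ ≤ ρ + (1 - ρ) := add_le_add (hρ t ⟨ht, hs⟩) h1
          _ = 1 := by ring
      · have h2 := hp.1.2.1 t ht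
        push Not at hs
        rw [abs_le] at h1 h2 ⊢
        rcases mul_neg_iff.1 hs with ⟨h3, h4⟩ | ⟨h3, h4⟩
        · have := mul_pos hδ0 h3
          constructor <;> linarith
        · have := mul_neg_of_pos_of_neg hδ0 h3
          constructor <;> linarith)
  have h1 := dualFunctional_eq_one hp.1
  have h2 : dualFunctional (objective ε p) ε (p + δ • f) =
      dualFunctional (objective ε p) ε p + δ * dualFunctional (objective ε p) ε f := by
    unfold dualFunctional
    rw [deriv_add (differentiable_of_mem_expKer hp.1.1 0)
      ((differentiable_of_mem_expKer hf 0).const_smul δ),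
      deriv_const_smul δ (differentiable_of_mem_expKer hf 0)]
    simp only [Pi.add_apply, Pi.smul_apply, smul_eq_mul]
    ring
  have := mul_pos hδ0 hpos
  linarith

theorem lt_of_forall_lt_succ {k : ℕ} {y : ℕ → ℝ} (hy : ∀ i < k, y i < y (i + 1)) {i j : ℕ}
    (hij : i < j) (hj : j ≤ k) : y i < y j := by
  induction j, hij using Nat.le_induction with
  | base => exact hy i (by omega)
  | succ j h ih => exact (ih (by omega)).trans (hy j (by omega))

theorem exists_pos_add_mul_pos {A : ℝ} (hA : 0 < A) (B : ℝ) : ∃ δ, 0 < δ ∧ 0 < A + δ * B := by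
  have hB : 0 < |B| + 1 := by positivity
  refine ⟨A / (|B| + 1), div_pos hA hB, ?_⟩
  have h1 : A / (|B| + 1) * (|B| + 1) = A := div_mul_cancel₀ _ hB.ne'
  have h2 : A / (|B| + 1) * -|B| ≤ A / (|B| + 1) * B :=
    mul_le_mul_of_nonneg_left (neg_abs_le B) (div_pos hA hB).le
  have h3 := div_pos hA hB
  linarith

/-- An optimal element alternates at `L.length - 1` positive points. -/
theorem IsExpOptimal.exists_alternation {L : List ℝ} (hL : ∀ b ∈ L, 0 < b) {ε : ℝ} (hε : 0 < ε)
    {p : ℝ → ℝ} (hp : IsExpOptimal L ε p) {k : ℕ} (hk : L.length = k + 2) :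
    ∃ x : ℕ → ℝ, (∀ i ≤ k, 0 < x i) ∧ (∀ i < k, x i < x (i + 1)) ∧
      ∀ i ≤ k, p (x i) = (-1) ^ i := by
  by_contra hc
  obtain ⟨W, hWk, hW0, hW⟩ := exists_separating (differentiable_of_mem_expKer hp.1.1).continuous
    k 0 1 abs_one (apply_zero_lt_one hp.1.1 hp.1.2.1 hε hp.1.2.2.le).ne (by simpa using hc)
  have h0W : (0 : ℝ) ∉ W := fun h => lt_irrefl _ (hW0 0 h)
  -- The subspaces have dimensions |W| + 1 for g and |W| + 2 for f, so that g vanishes only on W and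
  -- f only on W and at 0.
  obtain ⟨g, hg, -, hgs⟩ := exists_expKer_sign (L := L.drop (k + 1 - W.card)) W (by
    rw [List.length_drop]
    omega)
  have hLf : ∀ b ∈ L.drop (k - W.card), 0 < b := fun b hb => hL b (List.mem_of_mem_drop hb)
  obtain ⟨f, hf, hfW, hfs⟩ := exists_expKer_sign (L := L.drop (k - W.card)) (insert 0 W) (by
    rw [Finset.card_insert_of_notMem h0W, List.length_drop]
    omega)
  have hf0 : f 0 = 0 := hfW 0 (Finset.mem_insert_self _ _)
  have hfs' : ∀ t, 0 < t → t ∉ W → f t * ∏ w ∈ W, (w - t) < 0 := by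
    intro t ht htW
    have := hfs t (by simp [ht.ne', htW])
    rw [Finset.prod_insert h0W] at this
    have h1 : t * (f t * ∏ w ∈ W, (w - t)) < 0 := by linarith
    exact neg_of_mul_neg_right h1 ht.le
  have hd : deriv f 0 < 0 := by
    by_contra! hd
    obtain ⟨M, hM0, hMW⟩ := (Ioi_infinite (0 : ℝ)).exists_notMem_finset W
    have hz := expKer_eq_zero_of_zeros_sign_deriv hLf hf W
      (by rw [List.length_drop]; omega) hW0 (fun w hw => hfW w (Finset.mem_insert_of_mem hw))
      hf0.ge hd hM0 hMW (hfs' M hM0 hMW).le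
    have := hfs' M hM0 hMW
    simp [hz] at this
  have hf' := expKer_drop_le _ _ hf
  have hg' := expKer_drop_le _ _ hg
  -- The function -f increases the functional but vanishes at 0, which is an extremal point when
  -- p(0) = -1. A small multiple of g makes the opposition to p strict there too.
  obtain ⟨δ, hδ, hpos⟩ := exists_pos_add_mul_pos
    (mul_pos (objective_pos hε hp.1) (neg_pos.2 hd)) (dualFunctional (objective ε p) ε g)
  obtain ⟨t, ht, hpt, hft⟩ := hp.exists_extremal hL hε (f := -f + δ • g)
    ((expKer L).add_mem ((expKer L).neg_mem hf') ((expKer L).smul_mem _ hg')) (by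
      unfold dualFunctional at hpos ⊢
      rw [deriv_add (differentiable_of_mem_expKer hf' 0).neg
        ((differentiable_of_mem_expKer hg' 0).const_smul δ), deriv.neg,
        deriv_const_smul δ (differentiable_of_mem_expKer hg' 0)]
      simp only [Pi.add_apply, Pi.neg_apply, Pi.smul_apply, smul_eq_mul, hf0]
      linarith)
  obtain ⟨htW, hs⟩ := hW t ht hpt
  have h1 : 0 ≤ -f t * ∏ w ∈ W, (w - t) := by
    rcases ht.eq_or_lt with rfl | ht
    · simp [hf0]
    · have := hfs' t ht htW
      linarith
  have h2 : 0 < (-f t + δ * g t) * ∏ w ∈ W, (w - t) := by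
    have := mul_pos hδ (hgs t htW)
    linarith
  have h3 := mul_neg_of_pos_of_neg h2 hs
  have h4 : 0 ≤ ((-f t + δ * g t) * p t) * (∏ w ∈ W, (w - t)) ^ 2 :=
    mul_nonneg hft (sq_nonneg _)
  linarith

theorem dualFunctional_smul_add_smul {L : List ℝ} (κ ε : ℝ) {f g : ℝ → ℝ} (hf : f ∈ expKer L)
    (hg : g ∈ expKer L) (c e : ℝ) : dualFunctional κ ε (c • f + e • g) =
      c * dualFunctional κ ε f + e * dualFunctional κ ε g := by
  have hf' := differentiable_of_mem_expKer hf 0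
  have hg' := differentiable_of_mem_expKer hg 0
  unfold dualFunctional
  rw [deriv_add (hf'.const_smul c) (hg'.const_smul e), deriv_const_smul c hf',
    deriv_const_smul e hg']
  simp only [Pi.add_apply, Pi.smul_apply, smul_eq_mul]
  ring

/-- The extremal problem has only one solution. -/
theorem IsExpOptimal.unique {L : List ℝ} (hL : ∀ b ∈ L, 0 < b) (hL0 : L ≠ []) {ε : ℝ}
    (hε : 0 < ε) {p q : ℝ → ℝ} (hp : IsExpOptimal L ε p) (hq : IsExpOptimal L ε q) : p = q := by
  have hpq : objective ε q = objective ε p := le_antisymm (hq.2 p hp.1) (hp.2 q hq.1)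
  have hlp := dualFunctional_eq_one hp.1
  have hlq := dualFunctional_eq_one hq.1
  rw [hpq] at hlq
  have hf : p - q ∈ expKer L := (expKer L).sub_mem hp.1.1 hq.1.1
  obtain ⟨n, hn⟩ : ∃ n, L.length = n + 1 :=
    Nat.exists_eq_succ_of_ne_zero (by simpa [List.length_eq_zero_iff] using hL0)
  rcases n with _ | k
  -- In dimension one p and q are proportional, and the functional equals 1 on both.
  · have hz : q 0 • p + (-p 0) • q = 0 := by
      refine expKer_eq_zero_of_zeros ((expKer L).add_mem ((expKer L).smul_mem _ hp.1.1)
        ((expKer L).smul_mem _ hq.1.1)) {0} (by simp [hn]) fun x hx => ?_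
      rw [Finset.mem_singleton.1 hx]
      simp only [Pi.add_apply, Pi.smul_apply, smul_eq_mul]
      ring
    have h1 := dualFunctional_smul_add_smul (objective ε p) ε hp.1.1 hq.1.1 (q 0) (-p 0)
    rw [hz, hlp, hlq] at h1
    have h2 : p 0 = q 0 := by
      have : dualFunctional (objective ε p) ε 0 = 0 := by simp [dualFunctional]
      linarith
    refine sub_eq_zero.1 (expKer_eq_zero_of_zeros hf {0} (by simp [hn]) fun x hx => ?_)
    rw [Finset.mem_singleton.1 hx, Pi.sub_apply, h2, sub_self]
  · have hm : (1 / 2 : ℝ) • p + (1 / 2 : ℝ) • q ∈ expKer L :=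
      (expKer L).add_mem ((expKer L).smul_mem _ hp.1.1) ((expKer L).smul_mem _ hq.1.1)
    obtain ⟨hmo, -⟩ := isExpOptimal_of_dualFunctional_eq hε hp hm (fun t ht => by
      have h1 := abs_le.1 (hp.1.2.1 t ht)
      have h2 := abs_le.1 (hq.1.2.1 t ht)
      simp only [Pi.add_apply, Pi.smul_apply, smul_eq_mul]
      rw [abs_le]
      constructor <;> linarith) (by
      rw [dualFunctional_smul_add_smul _ _ hp.1.1 hq.1.1, hlp, hlq]
      norm_num)
    obtain ⟨x, hx0, hx, hxs⟩ := hmo.exists_alternation hL hε hn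
    -- The values ±1 are extreme in [-1, 1], so the midpoint attains them only where p and q both
    -- do. At the interior maximum x 0 the derivatives vanish as well, which gives p - q a double
    -- zero.
    have hval : ∀ i ≤ k, p (x i) = (-1) ^ i ∧ q (x i) = (-1) ^ i := by
      intro i hi
      have h1 := abs_le.1 (hp.1.2.1 _ (hx0 i hi).le)
      have h2 := abs_le.1 (hq.1.2.1 _ (hx0 i hi).le)
      have h3 := hxs i hi
      simp only [Pi.add_apply, Pi.smul_apply, smul_eq_mul] at h3
      rcases neg_one_pow_eq_or ℝ i with h | h <;> rw [h] at h3 ⊢ <;>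
      constructor <;> linarith
    have hder : ∀ r, IsExpOptimal L ε r → r (x 0) = 1 → deriv r (x 0) = 0 := by
      intro r hr h1
      refine IsLocalMax.deriv_eq_zero ?_
      filter_upwards [lt_mem_nhds (hx0 0 (by omega))] with t ht
      rw [h1]
      exact le_of_abs_le (hr.1.2.1 t ht.le)
    have hp0 : p (x 0) = 1 := by simpa using (hval 0 (by omega)).1
    have hq0 : q (x 0) = 1 := by simpa using (hval 0 (by omega)).2
    refine sub_eq_zero.1 (expKer_eq_zero_of_double_zero hL hf (a := x 0)
      ((Finset.range k).image fun i => x (i + 1)) ?_ ?_ ?_ ?_ ?_)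
    · rw [Finset.card_image_of_injOn, Finset.card_range, hn]
      intro i hi j hj hij
      simp only [Finset.coe_range, mem_Iio] at hi hj
      rcases lt_trichotomy i j with h | h | h
      · exact absurd hij (lt_of_forall_lt_succ hx (by omega) (by omega)).ne
      · exact h
      · exact absurd hij (lt_of_forall_lt_succ hx (by omega) (by omega)).ne'
    · intro z hz
      obtain ⟨i, hi, rfl⟩ := Finset.mem_image.1 hz
      rw [Finset.mem_range] at hi
      exact lt_of_forall_lt_succ hx (by omega) (by omega)
    · intro z hz
      obtain ⟨i, hi, rfl⟩ := Finset.mem_image.1 hz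
      rw [Finset.mem_range] at hi
      rw [Pi.sub_apply, (hval (i + 1) hi).1, (hval (i + 1) hi).2, sub_self]
    · rw [Pi.sub_apply, hp0, hq0, sub_self]
    · rw [deriv_sub (differentiable_of_mem_expKer hp.1.1 _)
        (differentiable_of_mem_expKer hq.1.1 _), hder p hp hp0, hder q hq hq0, sub_self]

/-! ### Comparison when the least exponent is enlarged -/

/-- If the least exponent is really present in `p` and is larger in `q`, then `c * p` dominates
`q` at infinity. -/
theorem eventually_sub_mul_neg {a a' : ℝ} {L : List ℝ} (haa : a < a') (hL : ∀ b ∈ L, a ≤ b)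
    {p q : ℝ → ℝ} (hp : p ∈ expKer (a :: L)) (hpL : p ∉ expKer L) (hq : q ∈ expKer (L ++ [a']))
    {c : ℝ} (hc : c ≠ 0) : ∀ᶠ t in atTop, (q t - c * p t) * (c * p t) < 0 := by
  obtain ⟨A, hA⟩ := exists_leading_coeff (a := a) (m := L.count a) rfl hp
  have hA0 : A ≠ 0 := by
    rintro rfl
    exact hpL (by simpa using hA)
  have h1 : Tendsto (fun t => q t / expMonomial (L.count a) a t) atTop (𝓝 0) := by
    refine tendsto_div_leading (L := L ++ [a']) (fun b hb => ?_) ?_ hq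
    · rcases List.mem_append.1 hb with h | h
      · exact hL b h
      · rw [List.mem_singleton.1 h]
        exact haa.le
    · rw [List.count_append, List.count_singleton]
      simp [haa.ne']
  have hpos : ∀ t : ℝ, 0 < t → 0 < expMonomial (L.count a) a t := fun t ht =>
    mul_pos (pow_pos ht _) (Real.exp_pos _)
  have h2 : Tendsto (fun t => p t / expMonomial (L.count a) a t) atTop (𝓝 A) := by
    have := (tendsto_div_leading hL rfl hA).add_const A
    rw [zero_add] at this
    refine this.congr' ?_
    filter_upwards [eventually_gt_atTop 0] with t ht
    have := (hpos t ht).ne'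
    simp only [Pi.sub_apply, Pi.smul_apply, smul_eq_mul]
    field_simp
    ring
  have h3 := (h1.sub (h2.const_mul c)).mul (h2.const_mul c)
  have h4 : (0 - c * A) * (c * A) < 0 := by
    have : 0 < (c * A) ^ 2 := by positivity
    linarith
  filter_upwards [h3.eventually (gt_mem_nhds h4), eventually_gt_atTop 0] with t ht ht0
  have hu := hpos t ht0
  have : (q t - c * p t) * (c * p t) = (q t / expMonomial (L.count a) a t -
      c * (p t / expMonomial (L.count a) a t)) * (c * (p t / expMonomial (L.count a) a t)) *
      expMonomial (L.count a) a t ^ 2 := by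
    field_simp
  rw [this]
  exact mul_neg_of_neg_of_pos ht (by positivity)

theorem exists_large_of_eventually {P : ℝ → Prop} (hP : ∀ᶠ t in atTop, P t) (Z : Finset ℝ)
    (a : ℝ) : ∃ s, P s ∧ a < s ∧ s ∉ Z := by
  have h : ∀ᶠ s in atTop, ∀ z ∈ Z, z < s :=
    (eventually_all_finset Z).2 fun z _ => eventually_gt_atTop z
  obtain ⟨s, h1, h2, h3⟩ := (hP.and ((eventually_gt_atTop a).and h)).exists
  exact ⟨s, h1, h2, fun hs => lt_irrefl _ (h3 s hs)⟩

/-- Comparison of two functions with common zeros that agree at the origin, the least exponent of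
the first being enlarged in the second. -/
theorem compare_of_common_zeros {a a' : ℝ} {L : List ℝ} (haa : a < a') (ha : 0 < a)
    (hL : ∀ b ∈ L, a ≤ b) {p q : ℝ → ℝ} (hp : p ∈ expKer (a :: L)) (hq : q ∈ expKer (L ++ [a']))
    {Z : Finset ℝ} (hZ : Z.card = L.length) (hZ0 : ∀ z ∈ Z, 0 < z) (hpZ : ∀ z ∈ Z, p z = 0)
    (hqZ : ∀ z ∈ Z, q z = 0) (hp0 : p 0 < 0) (hq0 : q 0 = p 0) :
    (∀ t, 0 < t → t ∉ Z → ∃ c, 0 < c ∧ c < 1 ∧ q t = c * p t) ∧ deriv p 0 < deriv q 0 := by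
  have hpM : p ∈ expKer (a :: (L ++ [a'])) := expKer_le_append_singleton a' (a :: L) hp
  have hqM : q ∈ expKer (a :: (L ++ [a'])) := expKer_le_cons a _ hq
  have hpne : p ≠ 0 := by
    rintro rfl
    exact lt_irrefl _ hp0
  have hpL : p ∉ expKer L := fun h => hpne (expKer_eq_zero_of_zeros h Z hZ hpZ)
  have h0Z : (0 : ℝ) ∉ Z := fun h => lt_irrefl _ (hZ0 0 h)
  have hP0 : 0 < ∏ z ∈ Z, (z - 0) := Finset.prod_pos fun z hz => by simpa using hZ0 z hz
  have hpP : ∀ t, t ∉ Z → p t * ∏ z ∈ Z, (z - t) < 0 := fun t ht =>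
    neg_of_mul_pos_right (expKer_sign_of_zeros hp hpne Z (by simp [hZ]) hpZ h0Z ht)
      (mul_neg_of_neg_of_pos hp0 hP0).le
  have hratio : ∀ t, 0 < t → t ∉ Z → ∃ c, 0 < c ∧ c < 1 ∧ q t = c * p t := by
    intro t ht htZ
    have hpt : p t ≠ 0 := fun h => by
      have := hpP t htZ
      simp [h] at this
    obtain ⟨c, hc⟩ : ∃ c, q t = c * p t := ⟨q t / p t, (div_mul_cancel₀ _ hpt).symm⟩
    have hcard : (insert t Z).card = L.length + 1 := by
      rw [Finset.card_insert_of_notMem htZ, hZ]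
    have hc0 : c ≠ 0 := by
      rintro rfl
      have := expKer_eq_zero_of_zeros hq (insert t Z) (by simp [hcard]) fun x hx => by
        rcases Finset.mem_insert.1 hx with rfl | hx
        · rw [hc, zero_mul]
        · exact hqZ x hx
      rw [this] at hq0
      exact hp0.ne hq0.symm
    have hFM : q - c • p ∈ expKer (a :: (L ++ [a'])) :=
      (expKer _).sub_mem hqM ((expKer _).smul_mem c hpM)
    have hev := eventually_sub_mul_neg haa hL hp hpL hq hc0
    obtain ⟨s, hs, hts, hsZ⟩ := exists_large_of_eventually hev Z t
    have hF0 : q - c • p ≠ 0 := fun h => by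
      have h1 : q s - c * p s = 0 := congrFun h s
      rw [h1, zero_mul] at hs
      exact lt_irrefl _ hs
    -- The zeros `insert t Z` of q - c p are one fewer than the dimension, so its sign at 0, where
    -- it equals (1 - c) p(0), determines its sign at s, where -c p dominates.
    have hsign := expKer_sign_of_zeros hFM hF0 (insert t Z) (by simp [hcard]) (fun x hx => by
      simp only [Pi.sub_apply, Pi.smul_apply, smul_eq_mul]
      rcases Finset.mem_insert.1 hx with rfl | hx
      · rw [hc, sub_self]
      · rw [hqZ x hx, hpZ x hx]
        simp) (s := 0) (t := s) (by simp [ht.ne, h0Z]) (by simp [hts.ne', hsZ])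
    rw [Finset.prod_insert htZ, Finset.prod_insert htZ] at hsign
    simp only [Pi.sub_apply, Pi.smul_apply, smul_eq_mul, hq0] at hsign
    have h1 := hpP s hsZ
    set F := q s - c * p s with hF
    set P := ∏ z ∈ Z, (z - s) with hP
    have h2 : 0 < (-p 0 * t * (s - t) * ∏ z ∈ Z, (z - 0)) * ((1 - c) * (F * P)) := by
      linarith
    have h3 : 0 < (1 - c) * (F * P) := pos_of_mul_pos_right h2
      (mul_pos (mul_pos (mul_pos (neg_pos.2 hp0) ht) (sub_pos.2 hts)) hP0).le
    have h4 : ((1 - c) * (F * p s)) * P ^ 2 < 0 := by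
      have := mul_neg_of_pos_of_neg h3 h1
      linarith
    have h5 : (1 - c) * (F * p s) < 0 := neg_of_mul_neg_left h4 (sq_nonneg _)
    -- Together with `h5` this says that c and 1 - c have the same sign, which leaves only 0 < c <
    -- 1.
    have h6 : c * (F * p s) < 0 := by linarith
    refine ⟨c, ?_, ?_, hc⟩
    · by_contra! hcn
      have h7 : 0 ≤ F * p s := by
        by_contra! h8
        have := mul_nonneg_of_nonpos_of_nonpos hcn h8.le
        linarith
      have := mul_nonneg (show 0 ≤ 1 - c by linarith) h7
      linarith
    · by_contra! hcn
      have h7 : 0 ≤ F * p s := by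
        by_contra! h8
        have := mul_nonneg_of_nonpos_of_nonpos (show 1 - c ≤ 0 by linarith) h8.le
        linarith
      have := mul_nonneg (show 0 ≤ c by linarith) h7
      linarith
  refine ⟨hratio, ?_⟩
  by_contra! hd
  have hM : ∀ b ∈ a :: (L ++ [a']), 0 < b := by
    intro b hb
    simp only [List.mem_cons, List.mem_append, List.not_mem_nil, or_false] at hb
    rcases hb with rfl | h | rfl
    · exact ha
    · exact ha.trans_le (hL b h)
    · exact ha.trans haa
  obtain ⟨s, hs0, hs, hsZ⟩ := exists_large_of_eventually (P := fun _ => True)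
    (Eventually.of_forall fun _ => trivial) Z 0
  obtain ⟨c, hc0, hc1, hc⟩ := hratio s hs hsZ
  -- If q'(0) ≤ p'(0), then p - q has nonnegative data at 0, and 0 < c < 1 gives it the sign of p at
  -- s; this forces p = q, against c < 1.
  have hz := expKer_eq_zero_of_zeros_sign_deriv hM (f := p - q) (a := 0)
    ((expKer _).sub_mem hpM hqM) Z (by simp [hZ]) hZ0
    (fun z hz => by rw [Pi.sub_apply, hpZ z hz, hqZ z hz, sub_self])
    (by rw [Pi.sub_apply, hq0, sub_self])
    (by rw [deriv_sub (differentiable_of_mem_expKer hpM 0) (differentiable_of_mem_expKer hqM 0)]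
        linarith) hs hsZ (by
      rw [Pi.sub_apply, hc]
      have := mul_neg_of_pos_of_neg (sub_pos.2 hc1) (hpP s hsZ)
      linarith)
  have h1 : p s - q s = 0 := congrFun hz s
  have h2 := hpP s hsZ
  have h3 : p s = 0 := by
    rw [hc] at h1
    have : (1 - c) * p s = 0 := by linarith
    exact (mul_eq_zero.1 this).resolve_left (by linarith)
  simp [h3] at h2

/-- Comparison of two functions with common zeros that agree to the second order at the origin,
the least exponent of the first being enlarged in the second. -/
theorem compare_of_common_zeros_deriv {a a' : ℝ} {L : List ℝ} (haa : a < a') (ha : 0 < a)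
    (hL : ∀ b ∈ L, a ≤ b) {p q : ℝ → ℝ} (hp : p ∈ expKer (a :: L)) (hq : q ∈ expKer (L ++ [a']))
    {Z : Finset ℝ} (hZ : Z.card + 1 = L.length) (hZ0 : ∀ z ∈ Z, 0 < z) (hpZ : ∀ z ∈ Z, p z = 0)
    (hqZ : ∀ z ∈ Z, q z = 0) (hp0 : 0 ≤ p 0) (hq0 : q 0 = p 0) (hdp : 0 < deriv p 0)
    (hdq : deriv q 0 = deriv p 0) :
    ∀ t, 0 < t → t ∉ Z → ∃ c, 0 < c ∧ c < 1 ∧ q t = c * p t := by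
  have hM : ∀ b ∈ a :: (L ++ [a']), 0 < b := by
    intro b hb
    simp only [List.mem_cons, List.mem_append, List.not_mem_nil, or_false] at hb
    rcases hb with rfl | h | rfl
    · exact ha
    · exact ha.trans_le (hL b h)
    · exact ha.trans haa
  have hpM : p ∈ expKer (a :: (L ++ [a'])) := expKer_le_append_singleton a' (a :: L) hp
  have hqM : q ∈ expKer (a :: (L ++ [a'])) := expKer_le_cons a _ hq
  have hpne : p ≠ 0 := by
    rintro rfl
    simp at hdp
  have hpL : p ∉ expKer L := fun h => hpne (expKer_eq_zero_of_sign_deriv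
    (fun b hb => ha.trans_le (hL b hb)) h Z hZ hZ0 hp0 hdp.le fun z hz => by simp [hpZ z hz])
  have hpP : ∀ t, 0 < t → t ∉ Z → 0 < p t * ∏ z ∈ Z, (z - t) := by
    intro t ht htZ
    by_contra! h
    exact hpne (expKer_eq_zero_of_zeros_sign_deriv
      (fun b hb => hM b (by simp only [List.mem_cons, List.mem_append] at hb ⊢; tauto)) hp Z
      (by simp [← hZ]) hZ0 hpZ hp0 hdp.le ht htZ h)
  intro t ht htZ
  have hpt : p t ≠ 0 := fun h => by
    have := hpP t ht htZ
    simp [h] at this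
  obtain ⟨c, hc⟩ : ∃ c, q t = c * p t := ⟨q t / p t, (div_mul_cancel₀ _ hpt).symm⟩
  have hcard : (insert t Z).card = L.length := by
    rw [Finset.card_insert_of_notMem htZ, hZ]
  have htZ0 : ∀ z ∈ insert t Z, 0 < z := by
    intro z hz
    rcases Finset.mem_insert.1 hz with rfl | hz
    · exact ht
    · exact hZ0 z hz
  have hc0 : c ≠ 0 := by
    rintro rfl
    have := expKer_eq_zero_of_sign_deriv (fun b hb => hM b (by simp only [List.mem_cons]; tauto))
      hq (insert t Z) (by simp [hcard]) htZ0 (hq0 ▸ hp0) (hdq ▸ hdp.le) fun x hx => by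
        rcases Finset.mem_insert.1 hx with rfl | hx
        · rw [hc, zero_mul, zero_mul]
        · rw [hqZ x hx, zero_mul]
    rw [this] at hdq
    simp [hdp.ne] at hdq
  have hev := eventually_sub_mul_neg haa hL hp hpL hq hc0
  obtain ⟨s, hs, hts, hsZ⟩ := exists_large_of_eventually hev Z t
  have h1 := hpP s (ht.trans hts) hsZ
  have hst : s ∉ insert t Z := by simp [hts.ne', hsZ]
  have hdp' := differentiable_of_mem_expKer hp 0
  have hdq' := differentiable_of_mem_expKer hq 0
  -- For c outside (0, 1), one choice σ = ±1 gives σ(q - c p) nonnegative data at 0 and a sign at s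
  -- that forces it to vanish.
  have key : ∀ σ : ℝ, σ * σ = 1 → 0 ≤ σ * (1 - c) → 0 ≤ σ * ((q s - c * p s) * p s) → False := by
    intro σ hσ h2 h3
    have hz := expKer_eq_zero_of_zeros_sign_deriv hM (f := σ • (q - c • p)) (a := 0)
      ((expKer _).smul_mem σ ((expKer _).sub_mem hqM ((expKer _).smul_mem c hpM))) (insert t Z)
      (by simp [hcard]) htZ0 (fun x hx => by
        simp only [Pi.sub_apply, Pi.smul_apply, smul_eq_mul]
        rcases Finset.mem_insert.1 hx with rfl | hx
        · rw [hc, sub_self, mul_zero]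
        · rw [hqZ x hx, hpZ x hx]
          simp) (by
        simp only [Pi.sub_apply, Pi.smul_apply, smul_eq_mul, hq0]
        have := mul_nonneg h2 hp0
        linarith) (by
        rw [deriv_const_smul σ (hdq'.sub (hdp'.const_smul c)), deriv_sub hdq' (hdp'.const_smul c),
          deriv_const_smul c hdp', hdq]
        simp only [smul_eq_mul]
        have := mul_nonneg h2 hdp.le
        linarith) (ht.trans hts) hst (by
        rw [Finset.prod_insert htZ]
        simp only [Pi.sub_apply, Pi.smul_apply, smul_eq_mul]
        set P := ∏ z ∈ Z, (z - s) with hP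
        have hps : p s ≠ 0 := fun h => by simp [h] at h1
        have h4 : 0 ≤ (σ * ((q s - c * p s) * p s)) * (p s * P) * (s - t) :=
          mul_nonneg (mul_nonneg h3 h1.le) (sub_pos.2 hts).le
        refine le_of_mul_le_mul_right (a := p s ^ 2) ?_ (by positivity)
        linarith)
    have h5 : σ * (q s - c * p s) = 0 := congrFun hz s
    have h6 : q s - c * p s = 0 := by
      have : σ * (σ * (q s - c * p s)) = 0 := by rw [h5, mul_zero]
      rwa [← mul_assoc, hσ, one_mul] at this
    rw [h6, zero_mul] at hs
    exact lt_irrefl _ hs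
  have h7 : c * ((q s - c * p s) * p s) < 0 := by linarith
  refine ⟨c, ?_, ?_, hc⟩
  · by_contra! hcn
    refine key 1 (one_mul 1) (by linarith) ?_
    by_contra! h8
    have := mul_nonneg_of_nonpos_of_nonpos hcn (show (q s - c * p s) * p s ≤ 0 by linarith)
    linarith
  · by_contra! hcn
    refine key (-1) (by norm_num) (by linarith) ?_
    by_contra! h8
    have := mul_nonneg (show 0 ≤ c by linarith)
      (show 0 ≤ (q s - c * p s) * p s by linarith)
    linarith

/-! ### Raising the exponents one at a time -/

theorem exists_expKer_hermite {L : List ℝ} (hL : ∀ b ∈ L, 0 < b) (Z : Finset ℝ)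
    (hZ : Z.card + 2 = L.length) (hZ0 : ∀ z ∈ Z, 0 < z) (u v : ℝ) :
    ∃ q ∈ expKer L, q 0 = u ∧ deriv q 0 = v ∧ ∀ z ∈ Z, q z = 0 := by
  let φ : expKer L →ₗ[ℝ] (Bool ⊕ Z → ℝ) :=
    { toFun := fun f => Sum.elim (fun b => cond b (f.1 0) (deriv f.1 0)) (fun z => f.1 z)
      map_add' := fun f g => by
        ext (b | z)
        · cases b
          · exact deriv_add (differentiable_of_mem_expKer f.2 0)
              (differentiable_of_mem_expKer g.2 0)
          · rfl
        · rfl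
      map_smul' := fun c f => by
        ext (b | z)
        · cases b
          · exact deriv_const_smul c (differentiable_of_mem_expKer f.2 0)
          · rfl
        · rfl }
  obtain ⟨q, hq⟩ := expKer_surjective_of_injective (by simp; omega) φ (fun f hf =>
    Subtype.ext (expKer_eq_zero_of_double_zero hL f.2 Z hZ hZ0
      (fun z hz => congrFun hf (Sum.inr ⟨z, hz⟩)) (congrFun hf (Sum.inl true))
      (congrFun hf (Sum.inl false))))
    (Sum.elim (fun b => cond b u v) fun _ => 0)
  exact ⟨q.1, q.2, congrFun hq (Sum.inl true), congrFun hq (Sum.inl false),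
    fun z hz => congrFun hq (Sum.inr ⟨z, hz⟩)⟩

/-- Enlarging the least exponent improves the value of the extremal problem. -/
theorem IsExpOptimal.exists_better {a a' : ℝ} {L : List ℝ} (haa : a < a') (ha : 0 < a)
    (hL : ∀ b ∈ L, a ≤ b) {ε : ℝ} (hε : 0 < ε) {p : ℝ → ℝ} (hp : IsExpOptimal (a :: L) ε p) :
    ∃ q ∈ expFeasible (L ++ [a']) ε, objective ε q < objective ε p := by
  have hLp : ∀ b ∈ a :: L, 0 < b := by
    intro b hb
    rcases List.mem_cons.1 hb with rfl | h
    · exact ha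
    · exact ha.trans_le (hL b h)
  have hNp : ∀ b ∈ L ++ [a'], 0 < b := by
    intro b hb
    rcases List.mem_append.1 hb with h | h
    · exact ha.trans_le (hL b h)
    · rw [List.mem_singleton.1 h]
      exact ha.trans haa
  have hpd := differentiable_of_mem_expKer hp.1.1
  have hp1 : p 0 < 1 := apply_zero_lt_one hp.1.1 hp.1.2.1 hε hp.1.2.2.le
  have hpos : 0 < deriv p 0 - ε * p 0 := sub_pos.2 hp.1.2.2
  have hbound : ∀ (Z : Finset ℝ) (q : ℝ → ℝ), (∀ z ∈ Z, q z = 0) →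
      (∀ t, 0 < t → t ∉ Z → ∃ c, 0 < c ∧ c < 1 ∧ q t = c * p t) → ∀ t, 0 < t → |q t| < 1 := by
    intro Z q hqZ hc t ht
    by_cases htZ : t ∈ Z
    · simp [hqZ t htZ]
    · obtain ⟨c, hc0, hc1, he⟩ := hc t ht htZ
      rw [he, abs_mul, abs_of_pos hc0]
      calc c * |p t| ≤ c * 1 := mul_le_mul_of_nonneg_left (hp.1.2.1 t ht.le) hc0.le
        _ < 1 := by linarith
  have halt : ∀ k, L.length = k + 1 → ∃ x : ℕ → ℝ, (∀ i ≤ k, 0 < x i) ∧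
      (∀ i < k, x i < x (i + 1)) ∧ ∀ i ≤ k, p (x i) = (-1) ^ i := fun k hk =>
    hp.exists_alternation hLp hε (by simp [hk])
  have hneg : ∀ i : ℕ, (-1 : ℝ) ^ i * (-1) ^ (i + 1) < 0 := by
    intro i
    rw [pow_succ, ← mul_assoc, ← mul_pow]
    norm_num
  rcases lt_or_ge (p 0) 0 with hp0 | hp0
  -- Since p(0) < 0, there is an additional zero between 0 and x 0, so matching the value alone at 0
  -- determines q.
  · obtain ⟨Z, hZc, hZ⟩ : ∃ Z : Finset ℝ, Z.card = L.length ∧ ∀ z ∈ Z, 0 < z ∧ p z = 0 := by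
      rcases hk : L.length with _ | k
      · exact ⟨∅, by simp, by simp⟩
      · obtain ⟨x, hx0, hx, hxs⟩ := halt k hk
        refine exists_zeros_of_alternating hpd.continuous (k + 1)
          (fun i => if i = 0 then 0 else x (i - 1)) (fun i hi => ?_) (fun i hi => ?_)
        · rcases i with _ | i
          · simpa using hx0 0 (by omega)
          · simpa using hx i (by omega)
        · rcases i with _ | i
          · have := hxs 0 (by omega)
            simp only [pow_zero] at this
            simpa [this] using hp0
          · simpa [hxs i (by omega), hxs (i + 1) (by omega)] using hneg i
    have h0Z : (0 : ℝ) ∉ Z := fun h => lt_irrefl _ (hZ 0 h).1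
    obtain ⟨q, hq, hqX⟩ := exists_expKer_interpolation (L := L ++ [a']) (insert 0 Z)
      (by rw [Finset.card_insert_of_notMem h0Z]; simp [hZc]) p
    have hq0 := hqX 0 (Finset.mem_insert_self _ _)
    have hqZ : ∀ z ∈ Z, q z = 0 := fun z hz =>
      (hqX z (Finset.mem_insert_of_mem hz)).trans (hZ z hz).2
    obtain ⟨hc, hd⟩ := compare_of_common_zeros haa ha hL hp.1.1 hq hZc (fun z hz => (hZ z hz).1)
      (fun z hz => (hZ z hz).2) hqZ hp0 hq0
    refine ⟨q, ⟨hq, fun t ht => ?_, ?_⟩, ?_⟩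
    · rcases ht.eq_or_lt with rfl | ht
      · rw [hq0]
        exact hp.1.2.1 0 le_rfl
      · exact (hbound Z q hqZ hc t ht).le
    · rw [hq0]
      exact hp.1.2.2.trans hd
    · unfold objective
      rw [hq0]
      exact div_lt_div_of_pos_left (sub_pos.2 hp1) hpos (by linarith)
  · have hdp : 0 < deriv p 0 := (mul_nonneg hε.le hp0).trans_lt hp.1.2.2
    rcases hk : L.length with _ | k
    -- With a single exponent p' = -a p, which contradicts p(0) ≥ 0 < p'(0).
    · rw [List.length_eq_zero_iff] at hk
      subst hk
      have h1 := congrFun (mem_expKer_nil.1 (mem_expKer_cons.1 hp.1.1).2) 0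
      simp only [Pi.zero_apply] at h1
      have := mul_nonneg ha.le hp0
      linarith
    · obtain ⟨x, hx0, hx, hxs⟩ := halt k hk
      obtain ⟨Z, hZc, hZ⟩ := exists_zeros_of_alternating hpd.continuous k x hx fun i hi => by
        rw [hxs i hi.le, hxs (i + 1) hi]
        exact hneg i
      have hZ0 : ∀ z ∈ Z, 0 < z := fun z hz => (hx0 0 (by omega)).trans (hZ z hz).1
      obtain ⟨q, hq, hq0, hdq, hqZ⟩ := exists_expKer_hermite hNp Z (by simp [hZc, hk]) hZ0
        (p 0) (deriv p 0)
      have hqd := differentiable_of_mem_expKer hq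
      have hc := compare_of_common_zeros_deriv haa ha hL hp.1.1 hq (by rw [hZc, hk]) hZ0
        (fun z hz => (hZ z hz).2) hqZ hp0 hq0 hdp hdq
      -- Here q has the same objective as p but norm at most ρ < 1; dividing by ρ replaces 1 by ρ in
      -- the numerator of the quotient.
      obtain ⟨ρ, hρ0, hρ1, hρ⟩ := exists_bound_lt_one hqd.continuous
        (tendsto_zero_of_mem_expKer hNp hq) isClosed_Ici subset_rfl (fun t (ht : 0 ≤ t) => by
          rcases ht.eq_or_lt with rfl | ht
          · rw [hq0, abs_of_nonneg hp0]
            exact hp1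
          · exact hbound Z q hqZ hc t ht)
      have hdq' : deriv (ρ⁻¹ • q) 0 = ρ⁻¹ * deriv p 0 := by
        rw [deriv_const_smul _ (hqd 0), hdq, smul_eq_mul]
      have hρi := inv_pos.2 hρ0
      refine ⟨ρ⁻¹ • q, ⟨(expKer _).smul_mem _ hq, fun t ht => ?_, ?_⟩, ?_⟩
      · rw [Pi.smul_apply, smul_eq_mul, abs_mul, abs_of_pos hρi, inv_mul_le_iff₀ hρ0, mul_one]
        exact hρ t ht
      · rw [hdq', Pi.smul_apply, smul_eq_mul, hq0]
        have := mul_pos hρi hpos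
        linarith
      · unfold objective
        rw [hdq', Pi.smul_apply, smul_eq_mul, hq0]
        have h1 : (1 - ρ⁻¹ * p 0) / (ρ⁻¹ * deriv p 0 - ε * (ρ⁻¹ * p 0)) =
            (ρ - p 0) / (deriv p 0 - ε * p 0) := by
          rw [div_eq_div_iff _ hpos.ne']
          · field_simp
          · have := mul_pos hρi hpos
            linarith
        rw [h1]
        exact div_lt_div_of_pos_right (by linarith) hpos

/-- The list is sorted, so its head is the least exponent; if it is below 1, it is replaced by a 1
at the end. That step is strict, and the remaining ones, by induction, do not increase the value. -/
theorem objective_lt_of_rotation {ε : ℝ} (hε : 0 < ε) : ∀ (L : List ℝ) (j : ℕ) (p p₁ : ℝ → ℝ),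
    L.Pairwise (· ≤ ·) → (∀ b ∈ L, 0 < b ∧ b ≤ 1) → 0 < L.length + j →
    IsExpOptimal (L ++ List.replicate j 1) ε p →
    IsExpOptimal (List.replicate (L.length + j) 1) ε p₁ →
    L ++ List.replicate j 1 = List.replicate (L.length + j) 1 ∨ objective ε p₁ < objective ε p := by
  intro L
  induction L with
  | nil => simp
  | cons a L ih =>
    intro j p p₁ hs hL hj hp hp₁
    obtain ⟨has, hs⟩ := List.pairwise_cons.1 hs
    have ha := hL a (by simp)
    rcases ha.2.eq_or_lt with h1 | h1
    · left
      have : L = List.replicate L.length 1 := List.eq_replicate_iff.2 ⟨rfl, fun b hb =>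
        le_antisymm (hL b (by simp [hb])).2 (h1 ▸ has b hb)⟩
      rw [h1, List.length_cons, List.cons_append, Nat.add_right_comm, List.replicate_succ]
      congr 1
      conv_lhs => rw [this]
      rw [List.replicate_append_replicate]
    · right
      obtain ⟨q, hq, hlt⟩ := IsExpOptimal.exists_better h1 ha.1 (fun b hb => by
        rcases List.mem_append.1 hb with h | h
        · exact has b h
        · rw [List.eq_of_mem_replicate h]
          exact ha.2) hε hp
      have he : L ++ List.replicate j 1 ++ [1] = L ++ List.replicate (j + 1) (1 : ℝ) := by
        rw [List.append_assoc, ← List.replicate_succ']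
      have hn : (a :: L).length + j = L.length + (j + 1) := by
        rw [List.length_cons]
        omega
      change q ∈ expFeasible (L ++ List.replicate j 1 ++ [1]) ε at hq
      rw [he] at hq
      rw [hn] at hp₁
      have hpos : ∀ b ∈ L ++ List.replicate (j + 1) (1 : ℝ), 0 < b := by
        intro b hb
        rcases List.mem_append.1 hb with h | h
        · exact (hL b (by simp [h])).1
        · rw [List.eq_of_mem_replicate h]
          exact one_pos
      obtain ⟨r, hr⟩ := exists_isExpOptimal hpos (by simp) hε
      refine lt_of_le_of_lt ?_ ((hr.2 q hq).trans_lt hlt)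
      rcases ih (j + 1) r p₁ hs (fun b hb => hL b (by simp [hb])) (by omega) hr hp₁ with h | h
      · rw [← h] at hp₁
        exact hp₁.2 r hr.1
      · exact h.le

/-! ### Exponents one and the Chebyshev polynomial -/

theorem exists_polynomial_of_mem_expKer_replicate {d : ℕ} {f : ℝ → ℝ}
    (hf : f ∈ expKer (List.replicate d 1)) :
    ∃ Q : Polynomial ℝ, ∀ t, f t = Q.eval t * Real.exp (-t) := by
  rw [expKer_eq_span] at hf
  induction hf using Submodule.span_induction with
  | mem f hf =>
    obtain ⟨k, b, h, rfl⟩ := hf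
    have hb : b = 1 := List.eq_of_mem_replicate (List.count_pos_iff.1 (Nat.zero_lt_of_lt h))
    exact ⟨Polynomial.X ^ k, fun t => by simp [expMonomial, hb]⟩
  | zero => exact ⟨0, by simp⟩
  | add f g _ _ hf hg =>
    obtain ⟨P, hP⟩ := hf
    obtain ⟨Q, hQ⟩ := hg
    exact ⟨P + Q, fun t => by rw [Pi.add_apply, hP, hQ, Polynomial.eval_add, add_mul]⟩
  | smul c f _ hf =>
    obtain ⟨P, hP⟩ := hf
    exact ⟨Polynomial.C c * P, fun t => by simp [hP, mul_assoc]⟩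

/-- A nonzero exponential polynomial with exponents one is unbounded on the left half-line. -/
theorem eq_zero_of_bounded_on_left {d : ℕ} {f : ℝ → ℝ}
    (hf : f ∈ expKer (List.replicate d 1)) (hb : ∀ t ≤ 0, |f t| ≤ 1) : f = 0 := by
  obtain ⟨Q, hQ⟩ := exists_polynomial_of_mem_expKer_replicate hf
  have hlim : Tendsto (fun t => (Q.comp (-Polynomial.X)).eval t) atTop (𝓝 0) := by
    refine squeeze_zero_norm' ?_ Real.tendsto_exp_neg_atTop_nhds_zero
    filter_upwards [eventually_ge_atTop 0] with t ht
    have h1 := hQ (-t)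
    have h2 : (Q.comp (-Polynomial.X)).eval t = f (-t) * Real.exp (-t) := by
      rw [h1, mul_assoc, ← Real.exp_add]
      simp
    rw [h2, norm_mul, Real.norm_eq_abs, Real.norm_eq_abs, Real.abs_exp]
    exact mul_le_of_le_one_left (Real.exp_pos _).le (hb _ (by linarith))
  have h0 : Q.comp (-Polynomial.X) = 0 :=
    Polynomial.leadingCoeff_eq_zero.1 ((Polynomial.tendsto_nhds_iff _).1 hlim).1
  funext t
  have h3 : (Q.comp (-Polynomial.X)).eval (-t) = 0 := by rw [h0, Polynomial.eval_zero]
  rw [Polynomial.eval_comp] at h3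
  simp only [Polynomial.eval_neg, Polynomial.eval_X, neg_neg] at h3
  rw [hQ, h3, zero_mul]
  rfl

/-- An optimal element increases up to its first maximum. -/
theorem IsExpOptimal.strictMonoOn {L : List ℝ} {ε : ℝ} (hε : 0 < ε)
    {p : ℝ → ℝ} (hp : IsExpOptimal L ε p) {k : ℕ} (hk : L.length = k + 2) {x : ℕ → ℝ}
    (hx0 : ∀ i ≤ k, 0 < x i) (hx : ∀ i < k, x i < x (i + 1))
    (hxs : ∀ i ≤ k, p (x i) = (-1) ^ i) : StrictMonoOn p (Iic (x 0)) := by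
  have hd := differentiable_of_mem_expKer hp.1.1
  have hp1 : p 0 < 1 := apply_zero_lt_one hp.1.1 hp.1.2.1 hε hp.1.2.2.le
  have hx01 : p (x 0) = 1 := by simpa using hxs 0 (by omega)
  have hder : ∀ i ≤ k, deriv p (x i) = 0 := by
    intro i hi
    rcases neg_one_pow_eq_or ℝ i with h | h
    · refine IsLocalMax.deriv_eq_zero ?_
      filter_upwards [lt_mem_nhds (hx0 i hi)] with t ht
      rw [hxs i hi, h]
      exact le_of_abs_le (hp.1.2.1 t ht.le)
    · refine IsLocalMin.deriv_eq_zero ?_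
      filter_upwards [lt_mem_nhds (hx0 i hi)] with t ht
      rw [hxs i hi, h]
      exact (abs_le.1 (hp.1.2.1 t ht.le)).1
  obtain ⟨ξ, hξ, he⟩ := exists_deriv_eq_slope p (hx0 0 (by omega)) hd.continuous.continuousOn
    hd.differentiableOn
  have hξ0 : 0 < deriv p ξ := by
    rw [he, hx01]
    exact div_pos (sub_pos.2 hp1) (sub_pos.2 (hx0 0 (by omega)))
  have hne : deriv p ≠ 0 := fun h => by
    rw [h] at hξ0
    exact lt_irrefl _ hξ0
  set X := (Finset.range (k + 1)).image x with hX
  have hmin : ∀ z ∈ X, x 0 ≤ z := by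
    intro z hz
    obtain ⟨i, hi, rfl⟩ := Finset.mem_image.1 hz
    rw [Finset.mem_range] at hi
    rcases Nat.eq_zero_or_pos i with rfl | h
    · exact le_rfl
    · exact (lt_of_forall_lt_succ hx h (by omega)).le
  have hXc : X.card = k + 1 := by
    rw [hX, Finset.card_image_of_injOn, Finset.card_range]
    intro i hi j hj hij
    simp only [Finset.coe_range, mem_Iio] at hi hj
    rcases lt_trichotomy i j with h | h | h
    · exact absurd hij (lt_of_forall_lt_succ hx h (by omega)).ne
    · exact h
    · exact absurd hij (lt_of_forall_lt_succ hx h (by omega)).ne'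
  have hpos : ∀ t < x 0, 0 < ∏ z ∈ X, (z - t) := fun t ht =>
    Finset.prod_pos fun z hz => sub_pos.2 (ht.trans_le (hmin z hz))
  have hnot : ∀ t < x 0, t ∉ X := fun t ht h => not_lt.2 (hmin t h) ht
  refine strictMonoOn_of_deriv_pos (convex_Iic _) hd.continuous.continuousOn fun t ht => ?_
  rw [interior_Iic] at ht
  -- The k + 1 alternation points are already all the zeros that p' may have, so p' keeps to the
  -- left of x 0 the positive sign found at ξ.
  have h1 := expKer_sign_of_zeros (deriv_mem_expKer hp.1.1) hne X (by omega) (fun z hz => by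
    obtain ⟨i, hi, rfl⟩ := Finset.mem_image.1 hz
    exact hder i (by rw [Finset.mem_range] at hi; omega)) (hnot ξ hξ.2) (hnot t ht)
  have h2 := pos_of_mul_pos_right h1 (mul_pos hξ0 (hpos ξ hξ.2)).le
  exact pos_of_mul_pos_left h2 (hpos t ht).le

theorem IsExpOptimal.strictMono_of_length_eq_one {L : List ℝ} (hL : ∀ b ∈ L, 0 < b) {ε : ℝ}
    (hε : 0 < ε) {p : ℝ → ℝ} (hp : IsExpOptimal L ε p) (hk : L.length = 1) : StrictMono p := by
  obtain ⟨a, rfl⟩ := List.length_eq_one_iff.1 hk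
  have ha : 0 < a := hL a (by simp)
  have hd : ∀ t, deriv p t = -a * p t := fun t => by
    have h : deriv p t + a * p t = 0 :=
      congrFun (mem_expKer_nil.1 (mem_expKer_cons.1 hp.1.1).2) t
    linarith
  have hp0 : p 0 < 0 := by
    have := hp.1.2.2
    rw [hd] at this
    have h1 : (ε + a) * p 0 < 0 := by linarith
    exact neg_of_mul_neg_right h1 (by positivity)
  have hne : p ≠ 0 := by
    rintro rfl
    exact lt_irrefl _ hp0
  refine strictMono_of_deriv_pos fun t => ?_
  have h1 := expKer_sign_of_zeros hp.1.1 hne ∅ (by simp) (by simp) (s := 0) (t := t)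
    (by simp) (by simp)
  simp only [Finset.prod_empty, mul_one] at h1
  have h2 := neg_of_mul_pos_right h1 hp0.le
  rw [hd]
  have := mul_pos ha (neg_pos.2 h2)
  linarith

/-- At the alternation points of U the bound on T makes T - U alternate weakly. Ordering the two
functions by their derivatives at 0 supplies the missing condition. -/
theorem isExpChebyshev_unique {d : ℕ} (hd : 1 ≤ d) {h : Fin d → ℝ} (hh : ∀ i, 0 < h i)
    {T U : ℝ → ℝ} (hT : IsExpChebyshev h T) (hU : IsExpChebyshev h U) : T = U := by
  have hL : ∀ b ∈ List.ofFn h, 0 < b := fun b hb => by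
    obtain ⟨i, rfl⟩ := List.mem_ofFn.1 hb
    exact hh i
  have key : ∀ T U, IsExpChebyshev h T → IsExpChebyshev h U → deriv U 0 ≤ deriv T 0 → T = U := by
    rintro T U ⟨hT, hT1, -⟩ ⟨hU, -, ν, hν, hν0, hνs⟩ hle
    rw [expPoly_eq_expKer] at hT hU
    have hTb := (halfLineNorm_le_one_iff hL hT).1 hT1.le
    have hν0' : ν ⟨0, hd⟩ = 0 := hν0 _ rfl
    have hnn : ∀ k, 0 ≤ ν k := fun k => hν0' ▸ hν.monotone (Fin.mk_le_of_le_val (Nat.zero_le _))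
    refine sub_eq_zero.1 (expKer_eq_zero_of_alternating_deriv hL ((expKer _).sub_mem hT hU)
      (k := d - 1) (by rw [List.length_ofFn]; omega)
      (fun i => if hi : i < d then ν ⟨i, hi⟩ else 0) (fun i hi => ?_) (fun i hi => ?_) ?_)
    · have h1 : i < d := by omega
      have h2 : i + 1 < d := by omega
      simp only [h1, h2, dif_pos]
      exact hν (by simp)
    · have h1 : i < d := by omega
      simp only [h1, dif_pos, Pi.sub_apply, hνs]
      have h2 := abs_le.1 (hTb _ (hnn ⟨i, h1⟩))
      rw [pow_succ]
      rcases neg_one_pow_eq_or ℝ i with h | h <;> rw [h] <;> linarith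
    · have h1 : 0 < d := hd
      simp only [h1, dif_pos, hν0']
      rw [deriv_sub (differentiable_of_mem_expKer hT 0) (differentiable_of_mem_expKer hU 0)]
      linarith
  rcases le_total (deriv U 0) (deriv T 0) with hle | hle
  · exact key T U hT hU hle
  · exact (key U T hU hT hle).symm

theorem ofFn_one (d : ℕ) : List.ofFn (1 : Fin d → ℝ) = List.replicate d 1 :=
  List.ofFn_const d 1

/-- An optimal element for exponents one is a translate of a Chebyshev polynomial. -/
theorem IsExpOptimal.exists_isExpChebyshev {d : ℕ} (hd : 1 ≤ d) {ε : ℝ} (hε : 0 < ε) {p : ℝ → ℝ}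
    (hp : IsExpOptimal (List.replicate d 1) ε p) :
    ∃ τ, 0 ≤ τ ∧ IsExpChebyshev (1 : Fin d → ℝ) (fun t => p (t - τ)) ∧
      ∀ t, -τ ≤ t → p t = 1 → 0 < t := by
  have hL : ∀ b ∈ List.replicate d (1 : ℝ), 0 < b := fun b hb => by
    rw [List.eq_of_mem_replicate hb]
    exact one_pos
  have hpd := differentiable_of_mem_expKer hp.1.1
  have hp1 : p 0 < 1 := apply_zero_lt_one hp.1.1 hp.1.2.1 hε hp.1.2.2.le
  obtain ⟨x, hx0, hx, hxs, hmono⟩ : ∃ x : ℕ → ℝ, (∀ i, i + 1 < d → 0 < x i) ∧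
      (∀ i, i + 2 < d → x i < x (i + 1)) ∧ (∀ i, i + 1 < d → p (x i) = (-1) ^ i) ∧
      StrictMonoOn p (Iic 0) := by
    rcases hd.eq_or_lt with rfl | hd
    · exact ⟨fun _ => 0, by simp, by simp, by simp,
        (hp.strictMono_of_length_eq_one hL hε (by simp)).strictMonoOn _⟩
    · have hk : (List.replicate d (1 : ℝ)).length = (d - 2) + 2 := by
        rw [List.length_replicate]
        omega
      obtain ⟨x, hx0, hx, hxs⟩ := hp.exists_alternation hL hε hk
      exact ⟨x, fun i hi => hx0 i (by omega), fun i hi => hx i (by omega),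
        fun i hi => hxs i (by omega), (hp.strictMonoOn hε hk hx0 hx hxs).mono
          (Iic_subset_Iic.2 (hx0 0 (by omega)).le)⟩
  have hp0 : -1 ≤ p 0 := (abs_le.1 (hp.1.2.1 0 le_rfl)).1
  -- By monotonicity p stays below 1 on the left, so if it also stayed above -1 it would be bounded
  -- there and hence zero.
  obtain ⟨s, hs0, hs⟩ : ∃ s ≤ 0, p s ≤ -1 := by
    by_contra! hc
    have hz := eq_zero_of_bounded_on_left hp.1.1 fun t ht => by
      rw [abs_le]
      exact ⟨(hc t ht).le, (hmono.monotoneOn ht self_mem_Iic ht).trans hp1.le⟩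
    have := hp.1.2.2
    simp [hz] at this
  obtain ⟨r, hr, hpr⟩ := intermediate_value_Icc hs0 hpd.continuous.continuousOn
    (show (-1 : ℝ) ∈ _ from ⟨hs, hp0⟩)
  have hr0 : r ≤ 0 := hr.2
  have hlt : ∀ t ≤ 0, p t < 1 := fun t ht =>
    (hmono.monotoneOn ht self_mem_Iic ht).trans_lt hp1
  have hbd : ∀ t, r ≤ t → |p t| ≤ 1 := by
    intro t ht
    rcases le_total t 0 with h | h
    · rw [abs_le]
      exact ⟨hpr ▸ hmono.monotoneOn hr0 h ht, (hlt t h).le⟩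
    · exact hp.1.2.1 t h
  refine ⟨-r, by linarith, ⟨?_, ?_, ?_⟩, fun t _ h1 => ?_⟩
  · rw [expPoly_eq_expKer, ofFn_one]
    exact translate_mem_expKer (-(-r)) hp.1.1
  · have hb : ∀ t, 0 ≤ t → |p (t - -r)| ≤ 1 := fun t ht => hbd _ (by linarith)
    refine le_antisymm (halfLineNorm_le hb) ?_
    have := le_halfLineNorm hb le_rfl
    simpa [hpr] using this
  · refine ⟨fun k => if k.val = 0 then 0 else x (k.val - 1) - r, ?_, ?_, ?_⟩
    · intro i j hij
      have hij' : i.val < j.val := hij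
      have hj := j.isLt
      by_cases hi : i.val = 0
      · have : j.val ≠ 0 := by omega
        simp only [hi, this, if_true, if_false]
        linarith [hx0 (j.val - 1) (by omega)]
      · have : j.val ≠ 0 := by omega
        simp only [hi, this, if_false]
        have := lt_of_forall_lt_succ (k := d - 2) (y := x) (fun i hi => hx i (by omega))
          (show i.val - 1 < j.val - 1 by omega) (by omega)
        linarith
    · intro k hk
      simp [hk]
    · intro k
      have hk := k.isLt
      by_cases h0 : k.val = 0
      · simp [h0, hpr]
      · simp only [h0, if_false]
        rw [show x (k.val - 1) - r - -r = x (k.val - 1) by ring, hxs _ (by omega),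
          show k.val + 1 = (k.val - 1) + 2 by omega, pow_add]
        norm_num
  · by_contra! h
    exact (hlt t h).ne h1

/-! ### Assembling the theorem -/

theorem isLeast_kappa {d : ℕ} {h : Fin d → ℝ} (hh : ∀ i, 0 < h i) {ε : ℝ} {p : ℝ → ℝ}
    (hp : IsExpOptimal (List.ofFn h) ε p) :
    kappa h ε = objective ε p ∧ IsLeast (objective ε '' feasible h ε) (kappa h ε) := by
  have hl : IsLeast (objective ε '' feasible h ε) (objective ε p) := by
    rw [feasible_eq hh]
    refine ⟨mem_image_of_mem _ hp.1, ?_⟩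
    rintro _ ⟨q, hq, rfl⟩
    exact hp.2 q hq
  have he : kappa h ε = objective ε p := hl.csInf_eq
  exact ⟨he, he ▸ hl⟩

theorem isOptimal_iff {d : ℕ} {h : Fin d → ℝ} (hh : ∀ i, 0 < h i) {ε : ℝ} {p : ℝ → ℝ} :
    IsOptimal h ε p ↔ IsExpOptimal (List.ofFn h) ε p := by
  rw [IsOptimal, IsExpOptimal, feasible_eq hh]

theorem theorem5 (d : ℕ) (hd : 1 ≤ d) :
    ∃ S : ℝ → ℝ, (∀ T : ℝ → ℝ, IsExpChebyshev (1 : Fin d → ℝ) T ↔ T = S) ∧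
      ∀ ε : ℝ, 0 < ε →
        -- the minimum defining `kappa` is attained for every exponent vector
        (∀ h ∈ expSimplex d, IsLeast (objective ε '' feasible h ε) (kappa h ε)) ∧
        -- the minimum over all exponent vectors is attained at the vector of ones, and only there
        (1 : Fin d → ℝ) ∈ expSimplex d ∧
        (∀ h ∈ expSimplex d, kappa (1 : Fin d → ℝ) ε ≤ kappa h ε) ∧
        (∀ h ∈ expSimplex d, h ≠ 1 → kappa (1 : Fin d → ℝ) ε < kappa h ε) ∧
        -- the optimal polynomial is unique, and it is the best nonnegative translate of `S`
        ∃ τ : ℝ, 0 ≤ τ ∧ (∀ t : ℝ, 0 ≤ t → S t = 1 → τ < t) ∧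
          (∀ p : ℝ → ℝ, IsOptimal (1 : Fin d → ℝ) ε p ↔ p = fun t => S (t + τ)) ∧
          kappa (1 : Fin d → ℝ) ε = (1 - S τ) / (deriv S τ - ε * S τ) ∧
          (∀ t : ℝ, 0 ≤ t → t ≠ τ → ε * S t < deriv S t →
            (1 - S τ) / (deriv S τ - ε * S τ) < (1 - S t) / (deriv S t - ε * S t)) := by
  have h1pos : ∀ i, 0 < (1 : Fin d → ℝ) i := fun _ => one_pos
  have hLpos : ∀ b ∈ List.replicate d (1 : ℝ), 0 < b := fun b hb => by
    rw [List.eq_of_mem_replicate hb]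
    exact one_pos
  have hL0 : List.replicate d (1 : ℝ) ≠ [] := by
    rw [Ne, List.replicate_eq_nil_iff]
    omega
  have hopt : ∀ ε : ℝ, 0 < ε → ∀ h ∈ expSimplex d, ∃ p, IsExpOptimal (List.ofFn h) ε p := by
    intro ε hε h hh
    refine exists_isExpOptimal (fun b hb => ?_) (fun h0 => ?_) hε
    · obtain ⟨i, rfl⟩ := List.mem_ofFn.1 hb
      exact (hh.2 i).1
    · have := congrArg List.length h0
      simp at this
      omega
  -- Existence of the Chebyshev polynomial comes from the extremal problem itself; ε = 1 is an
  -- arbitrary choice, since uniqueness makes S independent of ε.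
  obtain ⟨p₁, hp₁⟩ := exists_isExpOptimal hLpos hL0 one_pos
  obtain ⟨τ₁, -, hS, -⟩ := hp₁.exists_isExpChebyshev hd one_pos
  set S : ℝ → ℝ := fun t => p₁ (t - τ₁) with hSdef
  refine ⟨S, fun T => ⟨fun hT => isExpChebyshev_unique hd h1pos hT hS, fun hT => hT ▸ hS⟩,
    fun ε hε => ?_⟩
  have hSker : S ∈ expKer (List.replicate d 1) := by
    have := hS.1
    rwa [expPoly_eq_expKer, ofFn_one] at this
  have hSb := (halfLineNorm_le_one_iff hLpos hSker).1 hS.2.1.le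
  have h1mem : (1 : Fin d → ℝ) ∈ expSimplex d :=
    ⟨fun _ _ _ => le_rfl, fun _ => ⟨one_pos, le_rfl⟩⟩
  obtain ⟨p, hp⟩ := exists_isExpOptimal hLpos hL0 hε
  have hk1 : kappa (1 : Fin d → ℝ) ε = objective ε p :=
    (isLeast_kappa h1pos (by rwa [ofFn_one])).1
  have hstrict : ∀ h ∈ expSimplex d, h ≠ 1 → kappa (1 : Fin d → ℝ) ε < kappa h ε := by
    intro h hh hne
    obtain ⟨q, hq⟩ := hopt ε hε h hh
    rw [hk1, (isLeast_kappa (fun i => (hh.2 i).1) hq).1]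
    have hlen : (List.ofFn h).length + 0 = d := by simp
    refine (objective_lt_of_rotation hε (List.ofFn h) 0 q p ?_ ?_ (by omega) (by simpa using hq)
      (by rwa [hlen])).resolve_left fun he => hne ?_
    · rw [List.pairwise_ofFn]
      exact fun i j hij => hh.1 hij.le
    · intro b hb
      obtain ⟨i, rfl⟩ := List.mem_ofFn.1 hb
      exact hh.2 i
    · rw [List.replicate_zero, List.append_nil, hlen, ← ofFn_one] at he
      exact List.ofFn_injective he
  obtain ⟨τ, hτ0, hτS, hτ1⟩ := hp.exists_isExpChebyshev hd hε
  have hSp : (fun t => p (t - τ)) = S := isExpChebyshev_unique hd h1pos hτS hS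
  have hpS : p = fun t => S (t + τ) := by
    funext t
    rw [← hSp]
    simp
  have hobj : ∀ t, objective ε (fun u => S (u + t)) = (1 - S t) / (deriv S t - ε * S t) := by
    intro t
    unfold objective
    rw [deriv_comp_add_const]
    simp only [zero_add]
  refine ⟨fun h hh => ?_, h1mem, fun h hh => ?_, hstrict, τ, hτ0, fun t ht h1 => ?_, fun q => ?_,
    ?_, fun t ht htτ hlt => ?_⟩
  · obtain ⟨q, hq⟩ := hopt ε hε h hh
    exact (isLeast_kappa (fun i => (hh.2 i).1) hq).2
  · rcases eq_or_ne h 1 with rfl | hne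
    · exact le_rfl
    · exact (hstrict h hh hne).le
  · have := hτ1 (t - τ) (by linarith) (by rw [← h1, ← hSp])
    linarith
  · rw [isOptimal_iff h1pos, ofFn_one]
    exact ⟨fun hq => (hq.unique hLpos hL0 hε hp).trans hpS, fun hq => by rwa [hq, ← hpS]⟩
  · rw [hk1, ← hobj, ← hpS]
  · rw [← hobj τ, ← hobj t, ← hpS]
    have hmem : (fun u => S (u + t)) ∈ expFeasible (List.replicate d 1) ε :=
      ⟨translate_mem_expKer t hSker, fun u hu => hSb _ (by linarith), by
        rw [deriv_comp_add_const]
        simpa only [zero_add] using hlt⟩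
    refine lt_of_le_of_ne (hp.2 _ hmem) fun he => ?_
    have ht' : IsExpOptimal (List.replicate d 1) ε (fun u => S (u + t)) :=
      ⟨hmem, fun r hr => he ▸ hp.2 r hr⟩
    have heq : ∀ u, S (u + t) = S (u + τ) := fun u =>
      congrFun ((ht'.unique hLpos hL0 hε hp).trans hpS) u
    -- Two different optimal translations would make S periodic, and a periodic function that tends
    -- to 0 vanishes.
    have hper : Function.Periodic S (t - τ) := fun u => by
      have := heq (u - τ)
      rw [sub_add_cancel] at this
      rw [← this]
      congr 1
      ring
    have hzero : ∀ u, S u = 0 := by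
      intro u
      have hlim := tendsto_zero_of_mem_expKer hLpos hSker
      have hpa : Function.Periodic S |t - τ| := by
        rcases abs_choice (t - τ) with h | h <;> rw [h]
        · exact hper
        · exact hper.neg
      have h2 : Tendsto (fun n : ℕ => u + n * |t - τ|) atTop atTop :=
        tendsto_atTop_add_const_left _ _
          (tendsto_natCast_atTop_atTop.atTop_mul_const (abs_pos.2 (sub_ne_zero.2 htτ)))
      refine tendsto_nhds_unique (tendsto_const_nhds.congr fun n => ?_) (hlim.comp h2)
      exact ((hpa.nat_mul n) u).symm
    have := hlt
    rw [show S = fun _ => 0 from funext hzero] at this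
    simp at this
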